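/- Let $k$ be a field, $E$ an elliptic curve over $k$, and $\mathrm{Pic}(E)$ the group of isomorphism classes of line bundles on $E$, written additively, with $[M]$ the class of $M$. Tensor products of line bundles are written as products $L_1L_2$, and $H^0(L_1)H^0(L_2)$ denotes the tensor product $H^0(L_1)\otimes_k H^0(L_2)$ (similarly for three factors). Let $L$ be a line bundle on $E$ of degree $\ge 3$, and let $S\subset \mathrm{Pic}(E)$ be a subset such that for every $d\in\mathbb Z$ and all classes $[L_1],[L_2]\in\mathrm{Pic}(E)$ there are infinitely many $[M]\in S$ with $$\deg M=d,\qquad 2[M]\in S,\qquad [L_1]+[M]\in S,\qquad [L_2]-[M]\in S .$$ Then the sequence $$\bigoplus_{\substack{L_1L_2L_3=L\\ [L_3]\in S,\ [L_2L_3]\in S}} H^0(L_1)H^0(L_2)H^0(L_3)\ \xrightarrow{\ \alpha\ }\ \bigoplus_{\substack{L_1L_2=L\\ [L_2]\in S}} H^0(L_1)H^0(L_2)\ \xrightarrow{\ \beta\ }\ H^0(L)\ \longrightarrow\ 0$$ is exact. Here the sums run over the isomorphism classes of factorizations of $L$ (line bundles $L_i$ together with an isomorphism $L_1L_2\cong L$,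 respectively $L_1L_2L_3\cong L$) in which all $L_i$ have positive degree, with one representative chosen in each class; the map $\alpha$ sends $s_1\otimes s_2\otimes s_3$ to $s_1s_2\otimes s_3-s_1\otimes s_2s_3$, and $\beta$ sends $s_1\otimes s_2$ to $s_1s_2$. (In $\alpha$, the factorizations $(L_1L_2,L_3)$ and $(L_1,L_2L_3)$ are replaced by the chosen representatives of their classes; the resulting identification of $H^0(L_1)H^0(L_2)$ does not depend on the chosen isomorphism of factorizations, because an automorphism of a factorization multiplies the factors by inverse constants.) -/

import Mathlib

open scoped TensorProduct WithZero DirectSum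

noncomputable section

namespace CurveLB

universe u v

variable (k : Type u) (K : Type v) [Field k] [Field K] [Algebra k K]

/-- A closed point of the nonsingular projective curve with function field `K` over `k`, given by
its normalized discrete valuation: a surjective `ℤᵐ⁰`-valued valuation of `K` that is trivial
on `k`. Valuations are multiplicative, so `valuation f = exp (- ord f)`. -/
structure Place where
  valuation : Valuation K ℤᵐ⁰
  surjective : Function.Surjective valuation
  trivial_on_base : ∀ c : k, c ≠ 0 → valuation (algebraMap k K c) = 1

variable {k K}

theorem Place.valuation_algebraMap_le (P : Place k K) (c : k) :
    P.valuation (algebraMap k K c) ≤ 1 := by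
  by_cases hc : c = 0
  · simp [hc]
  · exact (P.trivial_on_base c hc).le

/-- The order of vanishing of a rational function at a closed point (`0` for `f = 0`). -/
def Place.ord (P : Place k K) (f : K) : ℤ := - WithZero.log (P.valuation f)

/-- The local ring of the curve at a closed point. -/
def Place.localRing (P : Place k K) : Subalgebra k K where
  carrier := {f | P.valuation f ≤ 1}
  mul_mem' {f g} hf hg := by
    simpa using mul_le_one' (show P.valuation f ≤ 1 from hf) (show P.valuation g ≤ 1 from hg)
  add_mem' {f g} hf hg := (P.valuation.map_add f g).trans (max_le hf hg)
  algebraMap_mem' c := P.valuation_algebraMap_le c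

/-- The maximal ideal of the local ring at a closed point. -/
def Place.maximalIdeal (P : Place k K) : Ideal P.localRing where
  carrier := {f | P.valuation (f : K) < 1}
  zero_mem' := by simp
  add_mem' {f g} hf hg := by
    simpa using (P.valuation.map_add (f : K) g).trans_lt (max_lt hf hg)
  smul_mem' c f hf := by
    have hc : P.valuation (c : K) ≤ 1 := c.2
    simpa using mul_lt_one_of_nonneg_of_lt_one_right hc zero_le hf

/-- The degree of a closed point: the degree of its residue field over `k`. -/
def Place.deg (P : Place k K) : ℕ := Module.finrank k (P.localRing ⧸ P.maximalIdeal)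

variable (k K) in
/-- Divisors on the curve. The divisor `D` stands for the line bundle `𝒪(D)`; tensor products and
duals of line bundles correspond to sums and negatives of divisors. -/
abbrev Div : Type v := Place k K →₀ ℤ

/-- The degree of a divisor, i.e. of the line bundle `𝒪(D)`. -/
def Div.deg : Div k K →+ ℤ := Finsupp.liftAddHom fun P => (AddMonoidHom.mulRight (P.deg : ℤ))

/-- `D` is the divisor of the nonzero rational function `f`. -/
def IsDivOf (D : Div k K) (f : K) : Prop := f ≠ 0 ∧ ∀ P : Place k K, D P = P.ord f

theorem IsDivOf.zero : IsDivOf (0 : Div k K) (1 : K) := ⟨one_ne_zero, by simp [Place.ord]⟩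

theorem IsDivOf.add {D D' : Div k K} {f f' : K} (h : IsDivOf D f) (h' : IsDivOf D' f') :
    IsDivOf (D + D') (f * f') := by
  refine ⟨mul_ne_zero h.1 h'.1, fun P => ?_⟩
  have := WithZero.log_mul (x := P.valuation f) (y := P.valuation f')
    (by simpa using h.1) (by simpa using h'.1)
  simp [h.2 P, h'.2 P, Place.ord, this]
  ring

theorem IsDivOf.neg {D : Div k K} {f : K} (h : IsDivOf D f) : IsDivOf (-D) f⁻¹ :=
  ⟨inv_ne_zero h.1, fun P => by simp [h.2 P, Place.ord, WithZero.log_inv]⟩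

variable (k K) in
/-- The subgroup of principal divisors. -/
def principal : AddSubgroup (Div k K) where
  carrier := {D | ∃ f : K, IsDivOf D f}
  zero_mem' := ⟨1, IsDivOf.zero⟩
  add_mem' := by rintro _ _ ⟨f, hf⟩ ⟨g, hg⟩; exact ⟨f * g, hf.add hg⟩
  neg_mem' := by rintro _ ⟨f, hf⟩; exact ⟨f⁻¹, hf.neg⟩

variable (k K) in
/-- The Picard group: divisors modulo linear equivalence, i.e. isomorphism classes of line
bundles, written additively. -/
abbrev Pic : Type v := Div k K ⧸ principal k K

/-- The isomorphism class `[𝒪(D)]`. -/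
def Pic.mk (D : Div k K) : Pic k K := QuotientAddGroup.mk D

/-- The class `c` consists of line bundles of degree `d`. -/
def Pic.HasDegree (c : Pic k K) (d : ℤ) : Prop := ∃ D : Div k K, Pic.mk D = c ∧ D.deg = d

/-- The class `c` consists of line bundles of positive degree. -/
def Pic.IsPos (c : Pic k K) : Prop := ∃ d : ℤ, 0 < d ∧ c.HasDegree d

theorem Pic.IsPos.add {c c' : Pic k K} (h : c.IsPos) (h' : c'.IsPos) : (c + c').IsPos := by
  obtain ⟨_, hd, D, rfl, rfl⟩ := h
  obtain ⟨_, hd', D', rfl, rfl⟩ := h'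
  exact ⟨_, add_pos hd hd', D + D', rfl, map_add _ _ _⟩

/-- The space `H⁰(𝒪(D))` of global sections: rational functions `f` which are zero or satisfy
`ord_P f ≥ - D P` at every closed point `P`. -/
def H0 (D : Div k K) : Submodule k K where
  carrier := {f | ∀ P : Place k K, P.valuation f ≤ WithZero.exp (D P)}
  zero_mem' P := by simp
  add_mem' {f g} hf hg P := (P.valuation.map_add f g).trans (max_le (hf P) (hg P))
  smul_mem' c f hf P := by
    rw [Algebra.smul_def, map_mul]
    exact (mul_le_of_le_one_left' (P.valuation_algebraMap_le c)).trans (hf P)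

/-- Multiplication of sections `H⁰(𝒪(D₁)) ⊗ H⁰(𝒪(D₂)) → H⁰(𝒪(D₃))`, where `D₁ + D₂ = D₃`. -/
def mulSections {D₁ D₂ D₃ : Div k K} (h : D₁ + D₂ = D₃) : H0 D₁ ⊗[k] H0 D₂ →ₗ[k] H0 D₃ :=
  TensorProduct.lift <| LinearMap.mk₂ k
    (fun s t => ⟨(s : K) * (t : K), fun P => by
      rw [map_mul, ← h, Finsupp.add_apply, WithZero.exp_add]
      exact mul_le_mul' (s.2 P) (t.2 P)⟩)
    (fun _ _ _ => Subtype.ext (by simp [add_mul]))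
    (fun _ _ _ => Subtype.ext (by simp))
    (fun _ _ _ => Subtype.ext (by simp [mul_add]))
    (fun _ _ _ => Subtype.ext (by simp))

/-- If `D - D'` is the divisor of `f`, multiplication by `f` is an isomorphism `𝒪(D) ≅ 𝒪(D')`;
this is the induced map on global sections. -/
def transport {D D' : Div k K} {f : K} (h : IsDivOf (D - D') f) : H0 D →ₗ[k] H0 D' where
  toFun s := ⟨f * (s : K), fun P => by
    have hf : P.valuation f = WithZero.exp (D' P - D P) := by
      rw [← WithZero.exp_log (x := P.valuation f) (by simpa using h.1)]
      have := h.2 P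
      simp only [Finsupp.sub_apply, Place.ord] at this
      congr 1
      linarith
    have := mul_le_mul' hf.le (s.2 P)
    rwa [← WithZero.exp_add, sub_add_cancel, ← map_mul] at this⟩
  map_add' _ _ := Subtype.ext (by simp [mul_add])
  map_smul' _ _ := Subtype.ext (by simp)

variable (k K) in
/-- A choice of a line bundle in every isomorphism class. -/
structure Representatives where
  bundle : Pic k K → Div k K
  mk_bundle : ∀ c, Pic.mk (bundle c) = c

section Complex

variable (r : Representatives k K)

/-- The chosen representative of `a + c` is isomorphic to the product of those of `a`, `c`. -/
theorem Representatives.exists_isDivOf (a c : Pic k K) :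
    ∃ f : K, IsDivOf (r.bundle a + r.bundle c - r.bundle (a + c)) f := by
  have h : Pic.mk (r.bundle (a + c)) = Pic.mk (r.bundle a + r.bundle c) := by
    rw [r.mk_bundle]
    exact (congrArg₂ (· + ·) (r.mk_bundle a) (r.mk_bundle c)).symm
  have := QuotientAddGroup.eq.mp h
  rwa [neg_add_eq_sub] at this

/-- A rational function inducing an isomorphism `M_a M_c ≅ M_{a+c}` of chosen representatives
(it is determined up to multiplication by a nonzero constant). -/
def Representatives.iso (a c : Pic k K) : K := (r.exists_isDivOf a c).choose

theorem Representatives.isDivOf_iso (a c : Pic k K) :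
    IsDivOf (r.bundle a + r.bundle c - r.bundle (a + c)) (r.iso a c) :=
  (r.exists_isDivOf a c).choose_spec

theorem Representatives.isDivOf_iso_inv (D : Div k K) (a c : Pic k K) :
    IsDivOf ((D - r.bundle a - r.bundle c) - (D - r.bundle (a + c))) (r.iso a c)⁻¹ := by
  have h := (r.isDivOf_iso a c).neg
  have e : (D - r.bundle a - r.bundle c) - (D - r.bundle (a + c)) =
    -(r.bundle a + r.bundle c - r.bundle (a + c)) := by abel
  rwa [e]

variable (D : Div k K) (S : Set (Pic k K))

/-- Isomorphism classes of factorizations `L₁ L₂ = L`, where `L = 𝒪(D)`, into line bundles of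
positive degree with `[L₂] ∈ S`. Such a class is determined by `c = [L₂]`. -/
structure PairIndex where
  c : Pic k K
  pos₁ : (Pic.mk D - c).IsPos
  pos₂ : c.IsPos
  mem : c ∈ S

/-- Isomorphism classes of factorizations `L₁ L₂ L₃ = L`, where `L = 𝒪(D)`, into line bundles of
positive degree with `[L₃] ∈ S` and `[L₂ L₃] ∈ S`. Such a class is determined by `a = [L₂]` and
`c = [L₃]`. -/
structure TripleIndex where
  a : Pic k K
  c : Pic k K
  pos₁ : (Pic.mk D - a - c).IsPos
  pos₂ : a.IsPos
  pos₃ : c.IsPos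
  mem : c ∈ S
  mem_add : a + c ∈ S

variable {D S}

/-- `(L₁, L₂, L₃) ↦ (L₁ L₂, L₃)`. -/
abbrev TripleIndex.left (t : TripleIndex D S) : PairIndex D S where
  c := t.c
  pos₁ := by
    have h := t.pos₁.add t.pos₂
    rwa [show Pic.mk D - t.a - t.c + t.a = Pic.mk D - t.c by abel] at h
  pos₂ := t.pos₃
  mem := t.mem

/-- `(L₁, L₂, L₃) ↦ (L₁, L₂ L₃)`. -/
abbrev TripleIndex.right (t : TripleIndex D S) : PairIndex D S where
  c := t.a + t.c
  pos₁ := by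
    have h := t.pos₁
    rwa [sub_sub] at h
  pos₂ := t.pos₂.add t.pos₃
  mem := t.mem_add

/-- The summand `H⁰(L₁) ⊗ H⁰(L₂)`: here `L₂` is the chosen representative of its class and
`L₁ = L L₂⁻¹`, so that `L₁ L₂ = L`. -/
abbrev PairSpace (p : PairIndex D S) : Type _ := H0 (D - r.bundle p.c) ⊗[k] H0 (r.bundle p.c)

/-- The summand `H⁰(L₁) ⊗ H⁰(L₂) ⊗ H⁰(L₃)`: here `L₂` and `L₃` are the chosen representatives of
their classes and `L₁ = L L₂⁻¹ L₃⁻¹`, so that `L₁ L₂ L₃ = L`. -/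
abbrev TripleSpace (t : TripleIndex D S) : Type _ :=
  H0 (D - r.bundle t.a - r.bundle t.c) ⊗[k] (H0 (r.bundle t.a) ⊗[k] H0 (r.bundle t.c))

/-- `s₁ ⊗ s₂ ⊗ s₃ ↦ s₁s₂ ⊗ s₃`. -/
def mulLeft (t : TripleIndex D S) : TripleSpace r t →ₗ[k] PairSpace r t.left :=
  TensorProduct.map
      (mulSections (show D - r.bundle t.a - r.bundle t.c + r.bundle t.a = D - r.bundle t.c by abel))
      LinearMap.id ∘ₗ
    (TensorProduct.assoc k _ _ _).symm.toLinearMap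

/-- `s₁ ⊗ s₂ ⊗ s₃ ↦ s₁ ⊗ s₂s₃`, followed by the identification of the factorization
`(L₁, L₂ L₃)` with the chosen representative of its isomorphism class; it multiplies the two
factors by inverse rational functions. -/
def mulRight (t : TripleIndex D S) : TripleSpace r t →ₗ[k] PairSpace r t.right :=
  TensorProduct.map (transport (r.isDivOf_iso_inv D t.a t.c))
    (transport (r.isDivOf_iso t.a t.c) ∘ₗ mulSections rfl)

instance instAddCommGroupPairSum : AddCommGroup (⨁ p : PairIndex D S, PairSpace r p) :=
  inferInstanceAs (AddCommGroup (@DirectSum (PairIndex D S) (PairSpace r)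
    fun p => (TensorProduct.addCommGroup : AddCommGroup (PairSpace r p)).toAddCommMonoid))

variable (D S)

open Classical in
/-- The map `α`, sending `s₁ ⊗ s₂ ⊗ s₃` to `s₁s₂ ⊗ s₃ - s₁ ⊗ s₂s₃`. -/
def alpha : (⨁ t : TripleIndex D S, TripleSpace r t) →ₗ[k] ⨁ p : PairIndex D S, PairSpace r p :=
  DirectSum.toModule k _ _ fun t =>
    DirectSum.lof k (PairIndex D S) (PairSpace r) t.left ∘ₗ mulLeft r t -
      DirectSum.lof k (PairIndex D S) (PairSpace r) t.right ∘ₗ mulRight r t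

open Classical in
/-- The map `β`, sending `s₁ ⊗ s₂` to `s₁s₂`. -/
def beta : (⨁ p : PairIndex D S, PairSpace r p) →ₗ[k] H0 D :=
  DirectSum.toModule k _ _ fun p => mulSections (sub_add_cancel D (r.bundle p.c))

end Complex

end CurveLB

end

/-! The proof has two halves, joined by `RiemannInequality`: closed points have positive degree,
`H⁰(𝒪) = k`, and `deg D ≤ h⁰(D)`. The second half uses nothing else about the curve.

First half. The affine coordinate ring of an elliptic curve is Dedekind (Jacobian criterion), so the
places of the function field are its maximal ideals and one point `∞` of degree one. Explicit
monomials give `h⁰(n∞) ≥ n`. Every divisor lies below some `Z + n∞`, where `Z` is the zero divisor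
of a polynomial function `u`; division by `u` gives the inequality for `Z + n∞`, and it passes down
to smaller divisors (`deg_le_finrank_H0`).

Second half. Bundles of degree one are `𝒪(P)` with `P` rational, and nontrivial bundles of degree `n
≥ 0` have `h⁰ ≤ n`. Counting dimensions, `H⁰(D - P) + H⁰(D - Q) = H⁰(D)` when `deg D ≥ 2`, `P ≁ Q`
and `D ≁ P + Q` (`H0_sup_eq`). Hence, modulo the image of `α`, a tensor whose second factor has
degree at least two can be rewritten with second factor the section `1` of `𝒪(P)` or `𝒪(Q)`; a
tensor whose second factor has degree one is first rewritten, by the same argument on its first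
factor, with second factor a section of some `L - R`. So the cokernel of `α` is spanned by `u ⊗ 1_P`
and `v ⊗ 1_Q` for two fixed points (`mkQ_symbol_mem`). If `β` kills `u ⊗ 1_P + v ⊗ 1_Q`, then `u =
-v` lies in `H⁰(L - P - Q)`, and both tensors come from the factorization `(L - P - Q, P + Q)`,
where they cancel (`symbol_sub_symbol_oneSection_mem`). The infinitude condition on `S` supplies
points with the required classes in `S` that avoid finitely many bad classes. -/

/-! ### Smoothness: the affine coordinate ring is a Dedekind domain. -/

namespace WeierstrassCurve.Affine.CoordinateRing

open Polynomial
open scoped Polynomial.Bivariate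

variable {k : Type*} [Field k] (W : WeierstrassCurve.Affine k)

/-- The cubic polynomial on the right hand side of the Weierstrass equation. -/
noncomputable def cubicPart : k[X] := X ^ 3 + C W.a₂ * X ^ 2 + C W.a₄ * X + C W.a₆

/-- The coefficient of `Y` in the Weierstrass equation. -/
noncomputable def linearPart : k[X] := C W.a₁ * X + C W.a₃

lemma mk_Y_sq : (mk W Y) ^ 2 + linearPart W • mk W Y = cubicPart W • (1 : W.CoordinateRing) := by
  have := smul_basis_mul_Y (W' := W) 0 1
  simp only [zero_smul, one_smul, zero_add, one_mul, zero_sub, neg_smul] at this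
  rw [sq, this, linearPart, cubicPart]
  abel

/-- The involution `Y ↦ -Y - a₁X - a₃` of the affine coordinate ring. -/
noncomputable def conj : W.CoordinateRing →ₐ[k[X]] W.CoordinateRing :=
  AdjoinRoot.liftAlgHom _ (Algebra.ofId _ _) (-mk W Y - algebraMap _ _ (linearPart W)) (by
    have h := mk_Y_sq W
    simp only [Algebra.smul_def, mul_one] at h
    simp only [polynomial, eval₂_add, eval₂_sub, eval₂_mul, eval₂_pow, eval₂_X, eval₂_C]
    change (-mk W Y - algebraMap _ _ (linearPart W)) ^ 2 + algebraMap _ _ (linearPart W) *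
      (-mk W Y - algebraMap _ _ (linearPart W)) - algebraMap _ _ (cubicPart W) = 0
    rw [← h]
    ring)

lemma conj_basis (p q : k[X]) : conj W (p • 1 + q • mk W Y) =
    p • 1 + q • (-mk W Y - algebraMap _ _ (linearPart W)) := by
  rw [map_add, map_smul, map_smul, map_one]
  congr 2
  exact AdjoinRoot.liftAlgHom_root ..

lemma conj_conj (u : W.CoordinateRing) : conj W (conj W u) = u := by
  obtain ⟨p, q, rfl⟩ := exists_smul_basis_eq u
  have h : conj W (mk W Y) = -mk W Y - algebraMap _ _ (linearPart W) := by
    simpa using conj_basis W 0 1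
  rw [conj_basis, map_add, map_smul, map_smul, map_sub, map_neg, AlgHom.commutes, map_one, h]
  ring_nf

lemma conj_injective : Function.Injective (conj W) :=
  (show Function.LeftInverse (conj W) (conj W) from conj_conj W).injective

lemma add_conj (p q : k[X]) : (p • 1 + q • mk W Y) + conj W (p • 1 + q • mk W Y) =
    algebraMap _ _ (2 * p - q * linearPart W) := by
  rw [conj_basis]
  simp only [Algebra.smul_def, map_sub, map_mul, map_ofNat]
  ring

lemma mul_conj (p q : k[X]) : (p • 1 + q • mk W Y) * conj W (p • 1 + q • mk W Y) =
    algebraMap _ _ (p ^ 2 - p * q * linearPart W - q ^ 2 * cubicPart W) := by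
  have h := mk_Y_sq W
  simp only [Algebra.smul_def, mul_one] at h
  rw [conj_basis]
  simp only [Algebra.smul_def, map_sub, map_mul, map_pow, ← h]
  ring

lemma isIntegral_polynomial (u : W.CoordinateRing) : _root_.IsIntegral k[X] u := by
  have : Module.Finite k[X] W.CoordinateRing := .of_basis (CoordinateRing.basis W)
  exact Algebra.IsIntegral.isIntegral u

lemma algebraMap_polynomial_injective :
    Function.Injective (algebraMap k[X] W.FunctionField) := by
  rw [IsScalarTower.algebraMap_eq k[X] W.CoordinateRing W.FunctionField]
  exact (IsFractionRing.injective W.CoordinateRing W.FunctionField).comp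
    (FaithfulSMul.algebraMap_injective k[X] W.CoordinateRing)

/-- A polynomial fraction which is integral over `k[X]` is a polynomial. -/
lemma dvd_of_isIntegral_div {p d : k[X]} (hd : d ≠ 0)
    (h : _root_.IsIntegral k[X] (algebraMap k[X] W.FunctionField p / algebraMap k[X] W.FunctionField d)) :
    d ∣ p := by
  have hinj := algebraMap_polynomial_injective W
  let φ : FractionRing k[X] →ₐ[k[X]] W.FunctionField :=
    IsFractionRing.liftAlgHom (g := Algebra.ofId k[X] W.FunctionField) hinj
  have hφ : φ (algebraMap _ _ p / algebraMap _ _ d) =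
      algebraMap k[X] W.FunctionField p / algebraMap k[X] W.FunctionField d := by
    rw [map_div₀, AlgHom.commutes, AlgHom.commutes]
  rw [← hφ, isIntegral_algHom_iff φ φ.toRingHom.injective] at h
  obtain ⟨q, hq⟩ := IsIntegrallyClosed.isIntegral_iff.mp h
  have hd' : algebraMap k[X] (FractionRing k[X]) d ≠ 0 := by
    simpa using hd
  rw [eq_div_iff hd', ← map_mul] at hq
  exact ⟨q, by rw [← IsFractionRing.injective k[X] (FractionRing k[X]) hq, mul_comm]⟩

/-- The Jacobian criterion: if an irreducible polynomial divides the trace, and its square divides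
the norm, of `p + qY`, then it divides `p` and `q`. -/
lemma dvd_of_dvd_trace_of_sq_dvd_norm [W.IsElliptic] {π p q : k[X]} (hπ : Irreducible π)
    (hT : π ∣ 2 * p - q * linearPart W)
    (hN : π ^ 2 ∣ p ^ 2 - p * q * linearPart W - q ^ 2 * cubicPart W) : π ∣ p ∧ π ∣ q := by
  by_cases hq : π ∣ q
  · refine ⟨?_, hq⟩
    have h1 : π ∣ p ^ 2 := by
      have h2 : π ∣ p * q * linearPart W + q ^ 2 * cubicPart W :=
        dvd_add (by rw [mul_assoc]; exact (hq.mul_right _).mul_left p)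
          ((dvd_pow hq two_ne_zero).mul_right _)
      have h3 := dvd_add ((dvd_pow_self π two_ne_zero).trans hN) h2
      ring_nf at h3
      exact h3
    exact hπ.prime.dvd_of_dvd_pow h1
  exfalso
  have : Fact (Irreducible π) := ⟨hπ⟩
  let f := AdjoinRoot.mk π
  have hf : ∀ {r : k[X]}, π ∣ r → f r = 0 := fun h => AdjoinRoot.mk_eq_zero.mpr h
  have hq0 : f q ≠ 0 := fun h => hq (AdjoinRoot.mk_eq_zero.mp h)
  have hN' : π ∣ derivative (p ^ 2 - p * q * linearPart W - q ^ 2 * cubicPart W) := by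
    obtain ⟨c, hc⟩ := hN
    rw [hc, derivative_mul, sq, derivative_mul]
    exact ⟨2 * derivative π * c + π * derivative c, by ring⟩
  have hD := hf hN'
  have hN0 := hf ((dvd_pow_self π two_ne_zero).trans hN)
  have hT0 := hf hT
  simp only [linearPart, cubicPart, derivative_sub, derivative_add, derivative_mul, derivative_pow,
    derivative_C, derivative_X] at hD
  have hC : ∀ a, f (C a) = AdjoinRoot.of π a := fun _ => rfl
  simp only [linearPart, cubicPart, map_sub, map_add, map_mul, map_pow, Nat.cast_ofNat, map_ofNat,
    map_one, map_zero, hC] at hD hN0 hT0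
  -- The norm is `q²` times the Weierstrass polynomial at `Y = -p/q`, so `(X, -p/q)` is a point over
  -- `k[X]/π`. There the trace condition kills the `Y`-derivative, and the derivative of the norm,
  -- which `π` still divides, then kills the `X`-derivative.
  have hE : Equation (W.map (AdjoinRoot.of π)) (f X) (-f p / f q) := by
    rw [equation_iff]
    simp only [map_a₁, map_a₂, map_a₃, map_a₄, map_a₆]
    field_simp
    linear_combination hN0
  have hns := ((nonsingular_iff ..).mp ((equation_iff_nonsingular ..).mp hE)).2
  simp only [map_a₁, map_a₂, map_a₃, map_a₄] at hns
  refine hns.elim (fun h => h ?_) (fun h => h ?_)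
  · field_simp
    refine mul_left_cancel₀ (pow_ne_zero 2 hq0) ?_
    linear_combination f q * hD - (f q * f (derivative p) - f (derivative q) * f p) * hT0 -
      2 * f (derivative q) * hN0
  · field_simp
    linear_combination -hT0

/-- Conjugation preserves integrality, so the trace and norm of `u/π` are integral over `k[X]`,
hence polynomials. These are the divisibilities needed for the Jacobian criterion. -/
lemma exists_smul_eq_of_isIntegral [W.IsElliptic] {π : k[X]} (hπ : Irreducible π)
    {u : W.CoordinateRing} (h : _root_.IsIntegral k[X]
      (algebraMap _ W.FunctionField u / algebraMap k[X] W.FunctionField π)) :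
    ∃ w : W.CoordinateRing, u = π • w := by
  have hinj : Function.Injective (algebraMap W.CoordinateRing W.FunctionField) :=
    IsFractionRing.injective _ _
  let ι := IsScalarTower.toAlgHom k[X] W.CoordinateRing W.FunctionField
  let σ : W.FunctionField →ₐ[k[X]] W.FunctionField :=
    IsFractionRing.liftAlgHom (g := ι.comp (conj W)) (hinj.comp (conj_injective W))
  have hσ : ∀ v : W.CoordinateRing, σ (algebraMap _ _ v) = algebraMap _ _ (conj W v) :=
    fun v => IsFractionRing.lift_algebraMap (g := (ι.comp (conj W)).toRingHom)
      (hinj.comp (conj_injective W)) v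
  have hπ0 : algebraMap k[X] W.FunctionField π ≠ 0 :=
    (map_ne_zero_iff _ (algebraMap_polynomial_injective W)).mpr hπ.ne_zero
  obtain ⟨p, q, rfl⟩ := exists_smul_basis_eq u
  have h' := h.map σ
  rw [map_div₀, AlgHom.commutes, hσ] at h'
  have hT := h.add h'
  have hN := h.mul h'
  rw [← add_div, ← map_add, add_conj, ← IsScalarTower.algebraMap_apply] at hT
  rw [div_mul_div_comm, ← map_mul, mul_conj, ← IsScalarTower.algebraMap_apply, ← map_mul,
    ← sq] at hN
  obtain ⟨⟨p, rfl⟩, ⟨q, rfl⟩⟩ := dvd_of_dvd_trace_of_sq_dvd_norm W hπ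
    (dvd_of_isIntegral_div W hπ.ne_zero hT)
    (dvd_of_isIntegral_div W (pow_ne_zero 2 hπ.ne_zero) hN)
  exact ⟨p • 1 + q • mk W Y, by rw [smul_add, smul_smul, smul_smul]⟩

lemma exists_smul_eq_of_isIntegral_div [W.IsElliptic] {d : k[X]} (hd : d ≠ 0) :
    ∀ {u : W.CoordinateRing}, _root_.IsIntegral k[X]
      (algebraMap _ W.FunctionField u / algebraMap k[X] W.FunctionField d) →
    ∃ w : W.CoordinateRing, u = d • w := by
  induction d using UniqueFactorizationMonoid.induction_on_prime with
  | h₁ => exact absurd rfl hd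
  | h₂ d h =>
    intro u _
    obtain ⟨e, rfl⟩ := h
    exact ⟨(↑e⁻¹ : k[X]) • u, by rw [smul_smul, Units.mul_inv, one_smul]⟩
  | h₃ d π hd' hπ ih =>
    intro u hu
    have hπ0 : algebraMap k[X] W.FunctionField π ≠ 0 :=
      (map_ne_zero_iff _ (algebraMap_polynomial_injective W)).mpr hπ.ne_zero
    have hd0 : algebraMap k[X] W.FunctionField d ≠ 0 :=
      (map_ne_zero_iff _ (algebraMap_polynomial_injective W)).mpr hd'
    obtain ⟨w, rfl⟩ := exists_smul_eq_of_isIntegral W hπ.irreducible (u := u) (by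
      have := hu.mul (isIntegral_algebraMap (R := k[X]) (A := W.FunctionField) (x := d))
      convert! this using 1
      rw [map_mul]
      field_simp)
    obtain ⟨w, rfl⟩ := ih hd' (u := w) (by
      convert! hu using 1
      rw [Algebra.smul_def, map_mul, map_mul, ← IsScalarTower.algebraMap_apply]
      field_simp)
    exact ⟨w, smul_smul ..⟩

/-- Multiplying numerator and denominator by the conjugate of the denominator makes the denominator
a polynomial, whose prime factors `exists_smul_eq_of_isIntegral_div` cancels one at a time. -/
instance isIntegrallyClosed [W.IsElliptic] : IsIntegrallyClosed W.CoordinateRing := by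
  rw [isIntegrallyClosed_iff W.FunctionField]
  intro x hx
  have : Algebra.IsIntegral k[X] W.CoordinateRing := ⟨isIntegral_polynomial W⟩
  have hx' : _root_.IsIntegral k[X] x := isIntegral_trans x hx
  obtain ⟨a, b, hb, rfl⟩ := IsFractionRing.div_surjective (A := W.CoordinateRing) x
  have hb0 : b ≠ 0 := nonZeroDivisors.ne_zero hb
  obtain ⟨p, q, rfl⟩ := exists_smul_basis_eq b
  have hd := mul_conj W p q
  set d := p ^ 2 - p * q * linearPart W - q ^ 2 * cubicPart W
  set b := p • 1 + q • mk W Y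
  have hcb : conj W b ≠ 0 := (map_ne_zero_iff _ (conj_injective W)).mpr hb0
  have hinj : Function.Injective (algebraMap W.CoordinateRing W.FunctionField) :=
    IsFractionRing.injective _ _
  have hd0 : d ≠ 0 := by
    intro h
    rw [h, map_zero] at hd
    exact mul_ne_zero hb0 hcb hd
  have key : algebraMap _ W.FunctionField a / algebraMap _ W.FunctionField b =
      algebraMap _ W.FunctionField (a * conj W b) / algebraMap k[X] W.FunctionField d := by
    rw [IsScalarTower.algebraMap_apply k[X] W.CoordinateRing W.FunctionField, ← hd, map_mul,
      map_mul, mul_div_mul_right]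
    exact (map_ne_zero_iff _ hinj).mpr hcb
  rw [key] at hx' ⊢
  obtain ⟨w, hw⟩ := exists_smul_eq_of_isIntegral_div W hd0 hx'
  refine ⟨w, ?_⟩
  rw [hw, Algebra.smul_def, map_mul, ← IsScalarTower.algebraMap_apply, mul_div_cancel_left₀]
  exact (map_ne_zero_iff _ (algebraMap_polynomial_injective W)).mpr hd0

instance isDedekindDomain [W.IsElliptic] : IsDedekindDomain W.CoordinateRing := by
  have : Module.Finite k[X] W.CoordinateRing := .of_basis (CoordinateRing.basis W)
  have : IsNoetherianRing W.CoordinateRing := .of_finite k[X] _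
  have : Algebra.IsIntegral k[X] W.CoordinateRing := ⟨isIntegral_polynomial W⟩
  have : Ring.DimensionLEOne W.CoordinateRing := .of_isIntegral k[X] _
  have : IsDedekindRing W.CoordinateRing := {}
  exact {}

end WeierstrassCurve.Affine.CoordinateRing

/-! ### The order of pole at infinity of a polynomial function. -/

namespace WeierstrassCurve.Affine.CoordinateRing

open Polynomial
open scoped Polynomial.Bivariate

variable {k : Type*} [Field k] (W : WeierstrassCurve.Affine k)

/-- The contributions `2 deg p` and `2 deg q + 3` have different parity and cannot cancel. A bound
on the pole order thus becomes a linear condition on coefficients, from which the ultrametric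
inequality is immediate. -/
lemma degree_norm_lt_iff (p q : k[X]) (n : ℕ) :
    (Algebra.norm k[X] (p • (1 : W.CoordinateRing) + q • mk W Y)).degree < n ↔
      (∀ i, n ≤ 2 * i → p.coeff i = 0) ∧ ∀ i, n ≤ 2 * i + 3 → q.coeff i = 0 := by
  have aux : ∀ (r : k[X]) (b : ℕ), 2 • r.degree + b < n ↔ ∀ i, n ≤ 2 * i + b → r.coeff i = 0 := by
    intro r b
    by_cases hr : r = 0
    · simp [hr]
    · rw [degree_eq_natDegree hr]
      have : 2 • (r.natDegree : WithBot ℕ) + b = ((2 * r.natDegree + b : ℕ) : WithBot ℕ) := by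
        push_cast; rw [nsmul_eq_mul]; rfl
      rw [this, Nat.cast_lt]
      refine ⟨fun h i hi => coeff_eq_zero_of_natDegree_lt (by omega), fun h => ?_⟩
      by_contra! hn
      exact hr (leadingCoeff_eq_zero.mp (h _ hn))
  rw [degree_norm_smul_basis, max_lt_iff]
  have h0 := aux p 0
  have h3 := aux q 3
  rw [Nat.cast_zero, add_zero] at h0
  exact and_congr h0 h3

lemma norm_eq_zero_iff {u : W.CoordinateRing} : Algebra.norm k[X] u = 0 ↔ u = 0 := by
  have : Module.Finite k[X] W.CoordinateRing := .of_basis (CoordinateRing.basis W)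
  exact Algebra.norm_eq_zero_iff

open Classical in
/-- The valuation at infinity on the affine coordinate ring: the order of the pole of `u` is the
degree of its norm. -/
noncomputable def infinityValuation : Valuation W.CoordinateRing ℤᵐ⁰ where
  toFun u := if u = 0 then 0 else WithZero.exp ((Algebra.norm k[X] u).natDegree : ℤ)
  map_zero' := by simp
  map_one' := by simp
  map_mul' u v := by
    by_cases hu : u = 0
    · simp [hu]
    by_cases hv : v = 0
    · simp [hv]
    rw [if_neg hu, if_neg hv, if_neg (mul_ne_zero hu hv), map_mul, natDegree_mul, Nat.cast_add,
      WithZero.exp_add]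
    · rwa [Ne, norm_eq_zero_iff]
    · rwa [Ne, norm_eq_zero_iff]
  map_add_le_max' u v := by
    by_cases hu : u = 0
    · simp [hu]
    by_cases hv : v = 0
    · simp [hv]
    rw [if_neg hu, if_neg hv]
    by_cases huv : u + v = 0
    · simp [huv]
    rw [if_neg huv]
    set n := max (Algebra.norm k[X] u).natDegree (Algebra.norm k[X] v).natDegree with hn
    have h : ∀ w : W.CoordinateRing, w ≠ 0 → ((Algebra.norm k[X] w).natDegree ≤ n ↔
        (Algebra.norm k[X] w).degree < (n + 1 : ℕ)) := fun w hw => by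
      rw [← natDegree_lt_iff_degree_lt, Nat.lt_succ_iff]
      rwa [Ne, norm_eq_zero_iff]
    have h1 := (h u hu).mp (le_max_left _ _)
    have h2 := (h v hv).mp (le_max_right _ _)
    have : (Algebra.norm k[X] (u + v)).natDegree ≤ n := by
      rw [h _ huv]
      obtain ⟨p, q, rfl⟩ := exists_smul_basis_eq u
      obtain ⟨p', q', rfl⟩ := exists_smul_basis_eq v
      rw [degree_norm_lt_iff] at h1 h2
      rw [show p • (1 : W.CoordinateRing) + q • mk W Y + (p' • 1 + q' • mk W Y) =
        (p + p') • 1 + (q + q') • mk W Y by simp only [add_smul]; abel, degree_norm_lt_iff]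
      exact ⟨fun i hi => by rw [coeff_add, h1.1 i hi, h2.1 i hi, add_zero],
        fun i hi => by rw [coeff_add, h1.2 i hi, h2.2 i hi, add_zero]⟩
    rw [le_max_iff, WithZero.exp_le_exp, WithZero.exp_le_exp, Nat.cast_le, Nat.cast_le]
    exact le_max_iff.mp this

lemma infinityValuation_of_ne_zero {u : W.CoordinateRing} (hu : u ≠ 0) :
    infinityValuation W u = WithZero.exp ((Algebra.norm k[X] u).natDegree : ℤ) :=
  if_neg hu

lemma infinityValuation_lt_exp_iff (p q : k[X]) (n : ℕ) :
    infinityValuation W (p • (1 : W.CoordinateRing) + q • mk W Y) < WithZero.exp (n : ℤ) ↔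
      (∀ i, n ≤ 2 * i → p.coeff i = 0) ∧ ∀ i, n ≤ 2 * i + 3 → q.coeff i = 0 := by
  rw [← degree_norm_lt_iff]
  by_cases hu : p • (1 : W.CoordinateRing) + q • mk W Y = 0
  · rw [hu, map_zero, (norm_eq_zero_iff W).mpr rfl, degree_zero]
    exact iff_of_true WithZero.exp_pos (WithBot.bot_lt_coe n)
  rw [infinityValuation_of_ne_zero W hu, WithZero.exp_lt_exp, Nat.cast_lt,
    ← natDegree_lt_iff_degree_lt]
  rwa [Ne, norm_eq_zero_iff]

lemma infinityValuation_ne_zero {u : W.CoordinateRing} (hu : u ≠ 0) :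
    infinityValuation W u ≠ 0 := by
  rw [infinityValuation_of_ne_zero W hu]
  exact WithZero.exp_ne_zero

lemma nonZeroDivisors_le_supp_primeCompl :
    nonZeroDivisors W.CoordinateRing ≤ (infinityValuation W).supp.primeCompl :=
  fun _ hu h => infinityValuation_ne_zero W (nonZeroDivisors.ne_zero hu) h

/-- Elements of the same order at infinity have a constant ratio up to lower order terms. -/
lemma exists_infinityValuation_sub_lt {u w : W.CoordinateRing} (hw : w ≠ 0)
    (h : infinityValuation W u ≤ infinityValuation W w) :
    ∃ c : k, infinityValuation W (u - algebraMap k _ c * w) < infinityValuation W w := by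
  have hwn := infinityValuation_of_ne_zero W hw
  set n := (Algebra.norm k[X] w).natDegree
  have hu : infinityValuation W u < WithZero.exp ((n + 1 : ℕ) : ℤ) := by
    refine (h.trans hwn.le).trans_lt ?_
    rw [WithZero.exp_lt_exp]
    push_cast
    omega
  have hw1 : infinityValuation W w < WithZero.exp ((n + 1 : ℕ) : ℤ) := by
    rw [hwn, WithZero.exp_lt_exp]
    push_cast
    omega
  have hw2 : ¬ infinityValuation W w < WithZero.exp (n : ℤ) := hwn.not_lt
  rw [hwn]
  obtain ⟨p, q, rfl⟩ := exists_smul_basis_eq u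
  obtain ⟨p', q', rfl⟩ := exists_smul_basis_eq w
  rw [infinityValuation_lt_exp_iff] at hu hw1 hw2
  have hsub : ∀ c : k, p • (1 : W.CoordinateRing) + q • mk W Y -
      algebraMap k _ c * (p' • 1 + q' • mk W Y) =
      (p - C c * p') • 1 + (q - C c * q') • mk W Y := by
    intro c
    rw [IsScalarTower.algebraMap_apply k k[X] W.CoordinateRing, ← Algebra.smul_def,
      Polynomial.algebraMap_apply, Algebra.algebraMap_self_apply]
    simp only [sub_smul, smul_add, smul_smul]
    abel
  -- The parity of `n` decides whether the leading term of `w` lies in `p'` or in `q'`; the constant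
  -- is the ratio of the coefficients there.
  by_cases hp : ∀ i, n = 2 * i → p'.coeff i = 0
  · by_cases hq : ∀ i, n = 2 * i + 3 → q'.coeff i = 0
    · refine absurd ⟨fun i hi => ?_, fun i hi => ?_⟩ hw2
      · rcases hi.eq_or_lt with h | h
        exacts [hp i h, hw1.1 i h]
      · rcases hi.eq_or_lt with h | h
        exacts [hq i h, hw1.2 i h]
    · push Not at hq
      obtain ⟨j, hj, hj'⟩ := hq
      refine ⟨q.coeff j / q'.coeff j, ?_⟩
      rw [hsub, infinityValuation_lt_exp_iff]
      refine ⟨fun i hi => ?_, fun i hi => ?_⟩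
      · rw [coeff_sub, coeff_C_mul, hu.1 i (by omega), hw1.1 i (by omega), mul_zero, sub_zero]
      · rcases hi.eq_or_lt with h | h
        · obtain rfl : i = j := by omega
          rw [coeff_sub, coeff_C_mul, div_mul_cancel₀ _ hj', sub_self]
        · rw [coeff_sub, coeff_C_mul, hu.2 i (by omega), hw1.2 i (by omega), mul_zero, sub_zero]
  · push Not at hp
    obtain ⟨j, hj, hj'⟩ := hp
    refine ⟨p.coeff j / p'.coeff j, ?_⟩
    rw [hsub, infinityValuation_lt_exp_iff]
    refine ⟨fun i hi => ?_, fun i hi => ?_⟩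
    · rcases hi.eq_or_lt with h | h
      · obtain rfl : i = j := by omega
        rw [coeff_sub, coeff_C_mul, div_mul_cancel₀ _ hj', sub_self]
      · rw [coeff_sub, coeff_C_mul, hu.1 i (by omega), hw1.1 i (by omega), mul_zero, sub_zero]
    · rw [coeff_sub, coeff_C_mul, hu.2 i (by omega), hw1.2 i (by omega), mul_zero, sub_zero]

lemma infinityValuation_X : infinityValuation W (algebraMap k[X] _ X) = WithZero.exp 2 := by
  have h : (algebraMap k[X] W.CoordinateRing X) = (X : k[X]) • 1 + (0 : k[X]) • mk W Y := by
    rw [zero_smul, add_zero, Algebra.algebraMap_eq_smul_one]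
  have h0 : (algebraMap k[X] W.CoordinateRing X) ≠ 0 := by
    rw [Ne, FaithfulSMul.algebraMap_eq_zero_iff]
    exact X_ne_zero
  rw [infinityValuation_of_ne_zero W h0, h, norm_smul_basis]
  simp

lemma infinityValuation_Y : infinityValuation W (mk W Y) = WithZero.exp 3 := by
  have h : mk W Y = (0 : k[X]) • 1 + (1 : k[X]) • mk W Y := by
    rw [zero_smul, zero_add, one_smul]
  have h0 : mk W Y ≠ 0 := by
    have := (CoordinateRing.basis W).ne_zero 1
    rwa [basis_one] at this
  rw [infinityValuation_of_ne_zero W h0, h, norm_smul_basis]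
  congr 2
  have : (X ^ 3 + C W.a₂ * X ^ 2 + C W.a₄ * X + C W.a₆).natDegree = 3 := by
    compute_degree!
  rw [zero_pow two_ne_zero, zero_mul, zero_mul, one_pow, one_mul, sub_zero, zero_sub,
    natDegree_neg, this]

lemma infinityValuation_algebraMap {c : k} (hc : c ≠ 0) :
    infinityValuation W (algebraMap k _ c) = 1 := by
  rw [infinityValuation_of_ne_zero W (by simpa using hc),
    IsScalarTower.algebraMap_apply k k[X] W.CoordinateRing]
  have : Module.Free k[X] W.CoordinateRing := inferInstance
  rw [Algebra.norm_algebraMap_of_basis (CoordinateRing.basis W)]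
  simp

end WeierstrassCurve.Affine.CoordinateRing

/-! ### The place at infinity and its characterization as the only pole of `x`. -/

namespace CurveLB

open Polynomial WeierstrassCurve.Affine WeierstrassCurve.Affine.CoordinateRing
open scoped Polynomial.Bivariate

variable {k : Type*} [Field k] (W : WeierstrassCurve.Affine k)

/-- The point at infinity of a Weierstrass curve. -/
noncomputable def infinityPlace : Place k W.FunctionField where
  valuation := (infinityValuation W).extendToLocalization
    (nonZeroDivisors_le_supp_primeCompl W) W.FunctionField
  surjective := by
    intro a
    rcases eq_or_ne a 0 with rfl | ha
    · exact ⟨0, map_zero _⟩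
    -- The function `Y/X` has a pole of order `3 - 2 = 1`, so its powers take every nonzero value.
    · refine ⟨(algebraMap _ _ (mk W Y) / algebraMap _ _ (algebraMap k[X] W.CoordinateRing X)) ^
        (WithZero.log a), ?_⟩
      rw [map_zpow₀, map_div₀, Valuation.extendToLocalization_apply_map_apply,
        Valuation.extendToLocalization_apply_map_apply, infinityValuation_X, infinityValuation_Y,
        ← WithZero.exp_sub, ← WithZero.exp_zsmul]
      simp [WithZero.exp_log ha]
  trivial_on_base c hc := by
    rw [IsScalarTower.algebraMap_apply k W.CoordinateRing W.FunctionField,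
      Valuation.extendToLocalization_apply_map_apply, infinityValuation_algebraMap W hc]

lemma infinityPlace_algebraMap (u : W.CoordinateRing) :
    (infinityPlace W).valuation (algebraMap _ _ u) = infinityValuation W u :=
  Valuation.extendToLocalization_apply_map_apply _ (nonZeroDivisors_le_supp_primeCompl W) _ _

section PlaceGeneral

variable {k : Type*} {K : Type*} [Field k] [Field K] [Algebra k K]

lemma Place.ext {P Q : Place k K} (h : P.valuation = Q.valuation) : P = Q := by
  cases P
  cases Q
  congr

lemma Place.mem_localRing {P : Place k K} {f : K} : f ∈ P.localRing ↔ P.valuation f ≤ 1 := Iff.rfl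

lemma Place.mem_maximalIdeal {P : Place k K} {f : P.localRing} :
    f ∈ P.maximalIdeal ↔ P.valuation (f : K) < 1 := Iff.rfl

lemma Place.one_notMem_maximalIdeal (P : Place k K) : (1 : P.localRing) ∉ P.maximalIdeal := by
  rw [Place.mem_maximalIdeal]
  simp

instance (P : Place k K) : Nontrivial (P.localRing ⧸ P.maximalIdeal) :=
  Ideal.Quotient.nontrivial_iff.mpr ((Ideal.ne_top_iff_one _).mpr P.one_notMem_maximalIdeal)

lemma Place.deg_eq_one {P : Place k K}
    (h : ∀ f : K, P.valuation f ≤ 1 → ∃ c : k, P.valuation (f - algebraMap k K c) < 1) :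
    P.deg = 1 := by
  refine finrank_eq_one (1 : P.localRing ⧸ P.maximalIdeal) one_ne_zero fun x => ?_
  obtain ⟨⟨f, hf⟩, rfl⟩ := Ideal.Quotient.mk_surjective x
  obtain ⟨c, hc⟩ := h f hf
  refine ⟨c, ?_⟩
  change Ideal.Quotient.mk P.maximalIdeal (c • (1 : P.localRing)) = _
  refine (Ideal.Quotient.eq.mpr ?_).symm
  rw [Algebra.algebraMap_eq_smul_one] at hc
  exact hc

end PlaceGeneral

lemma infinityPlace_deg : (infinityPlace W).deg = 1 := by
  refine Place.deg_eq_one fun f hf => ?_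
  obtain ⟨a, b, hb, rfl⟩ := IsFractionRing.div_surjective (A := W.CoordinateRing) f
  have hb0 : b ≠ 0 := nonZeroDivisors.ne_zero hb
  have hv0 : 0 < infinityValuation W b := zero_lt_iff.mpr (infinityValuation_ne_zero W hb0)
  have hbK : algebraMap W.CoordinateRing W.FunctionField b ≠ 0 :=
    (map_ne_zero_iff _ (IsFractionRing.injective _ _)).mpr hb0
  rw [map_div₀, infinityPlace_algebraMap, infinityPlace_algebraMap,
    div_le_one₀ hv0] at hf
  obtain ⟨c, hc⟩ := exists_infinityValuation_sub_lt W hb0 hf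
  refine ⟨c, ?_⟩
  have : algebraMap W.CoordinateRing W.FunctionField a / algebraMap _ _ b -
      algebraMap k W.FunctionField c =
      algebraMap _ _ (a - algebraMap k _ c * b) / algebraMap _ _ b := by
    rw [map_sub, map_mul, sub_div, mul_div_cancel_right₀ _ hbK, ← IsScalarTower.algebraMap_apply]
  rw [this, map_div₀, infinityPlace_algebraMap, infinityPlace_algebraMap, div_lt_one₀ hv0]
  exact hc

/-- The `x`-coordinate function. -/
noncomputable abbrev xFun : W.FunctionField :=
  algebraMap W.CoordinateRing W.FunctionField (algebraMap k[X] W.CoordinateRing X)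

/-- The `y`-coordinate function. -/
noncomputable abbrev yFun : W.FunctionField :=
  algebraMap W.CoordinateRing W.FunctionField (mk W Y)

lemma weierstrass_equation : yFun W * (yFun W + (algebraMap k _ W.a₁ * xFun W +
    algebraMap k _ W.a₃)) = xFun W ^ 3 + algebraMap k _ W.a₂ * xFun W ^ 2 +
      algebraMap k _ W.a₄ * xFun W + algebraMap k _ W.a₆ := by
  have h := congrArg (algebraMap W.CoordinateRing W.FunctionField) (mk_Y_sq W)
  simp only [Algebra.smul_def, linearPart, cubicPart, mul_one, map_add, map_mul, map_pow] at h
  have hC : ∀ a : k, algebraMap W.CoordinateRing W.FunctionField (algebraMap k[X] _ (C a)) =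
      algebraMap k _ a := fun a => by
    rw [IsScalarTower.algebraMap_apply k W.CoordinateRing W.FunctionField,
      IsScalarTower.algebraMap_apply k k[X] W.CoordinateRing]
    rfl
  rw [hC, hC, hC, hC, hC] at h
  rw [← h]
  ring

lemma algebraMap_basis (p q : k[X]) :
    algebraMap W.CoordinateRing W.FunctionField (p • 1 + q • mk W Y) =
      aeval (xFun W) p + aeval (xFun W) q * yFun W := by
  have h : ∀ p : k[X], algebraMap W.CoordinateRing W.FunctionField (algebraMap k[X] _ p) =
      aeval (xFun W) p := fun p => by
    have := aeval_algebraMap_apply W.FunctionField (algebraMap k[X] W.CoordinateRing X) p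
    rw [this, aeval_algebraMap_apply, aeval_X_left_apply]
  rw [Algebra.smul_def, Algebra.smul_def, map_add, map_mul, map_mul, map_one, h, h, mul_one]

/-- A place at which `x` has no pole is centred on the affine curve. -/
lemma valuation_algebraMap_le_one {P : Place k W.FunctionField}
    (hP : P.valuation (xFun W) ≤ 1) (u : W.CoordinateRing) :
    P.valuation (algebraMap _ _ u) ≤ 1 := by
  have hx : xFun W ∈ P.localRing := hP
  have hy : yFun W ∈ P.localRing := by
    -- If `y` had a pole, so would `y (y + a₁x + a₃)`, but the cubic in `x` has none.
    by_contra hy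
    rw [Place.mem_localRing, not_le] at hy
    have h1 : P.valuation (algebraMap k _ W.a₁ * xFun W + algebraMap k _ W.a₃) ≤ 1 :=
      P.localRing.add_mem (P.localRing.mul_mem (P.localRing.algebraMap_mem _) hx)
        (P.localRing.algebraMap_mem _)
    have h2 : xFun W ^ 3 + algebraMap k _ W.a₂ * xFun W ^ 2 +
        algebraMap k _ W.a₄ * xFun W + algebraMap k _ W.a₆ ∈ P.localRing :=
      P.localRing.add_mem (P.localRing.add_mem (P.localRing.add_mem (P.localRing.pow_mem hx 3)
        (P.localRing.mul_mem (P.localRing.algebraMap_mem _) (P.localRing.pow_mem hx 2)))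
        (P.localRing.mul_mem (P.localRing.algebraMap_mem _) hx)) (P.localRing.algebraMap_mem _)
    rw [← weierstrass_equation, Place.mem_localRing, map_mul,
      Valuation.map_add_eq_of_lt_left _ (h1.trans_lt hy)] at h2
    exact absurd h2 (not_le.mpr (one_lt_mul_of_lt_of_le hy hy.le))
  have hpoly : ∀ p : k[X], aeval (xFun W) p ∈ P.localRing := fun p => by
    have := (aeval (⟨xFun W, hx⟩ : P.localRing) p).2
    rwa [aeval_subalgebra_coe] at this
  obtain ⟨p, q, rfl⟩ := exists_smul_basis_eq u
  rw [algebraMap_basis]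
  exact P.localRing.add_mem (hpoly p) (P.localRing.mul_mem (hpoly q) hy)

lemma infinityPlace_xFun : (infinityPlace W).valuation (xFun W) = WithZero.exp 2 := by
  rw [infinityPlace_algebraMap, infinityValuation_X]

/-- The point at infinity is the only pole of `x`. -/
lemma eq_infinityPlace {P : Place k W.FunctionField} (hP : ¬ P.valuation (xFun W) ≤ 1) :
    P = infinityPlace W := by
  have hx0 : P.valuation (xFun W) ≠ 0 := fun h => hP (by rw [h]; exact zero_le)
  obtain ⟨a, ha⟩ : ∃ a : ℤ, P.valuation (xFun W) = WithZero.exp a :=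
    ⟨_, (WithZero.exp_log hx0).symm⟩
  rw [ha, ← WithZero.exp_zero, WithZero.exp_le_exp, not_le] at hP
  have hconst : ∀ c : k, P.valuation (algebraMap k _ c) ≤ WithZero.exp 0 := fun c =>
    P.valuation_algebraMap_le c
  have hcubic : P.valuation (xFun W ^ 3 + algebraMap k _ W.a₂ * xFun W ^ 2 +
      algebraMap k _ W.a₄ * xFun W + algebraMap k _ W.a₆) = WithZero.exp (3 * a) := by
    have h3 : P.valuation (xFun W ^ 3) = WithZero.exp (3 * a) := by
      rw [map_pow, ha, ← WithZero.exp_nsmul]; simp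
    have h2 : P.valuation (algebraMap k _ W.a₂ * xFun W ^ 2) < WithZero.exp (3 * a) := by
      rw [map_mul, map_pow, ha, ← WithZero.exp_nsmul]
      refine (mul_le_mul_left (hconst _) _).trans_lt ?_
      rw [← WithZero.exp_add, WithZero.exp_lt_exp, nsmul_eq_mul]
      push_cast; omega
    have h1 : P.valuation (algebraMap k _ W.a₄ * xFun W) < WithZero.exp (3 * a) := by
      rw [map_mul, ha]
      refine (mul_le_mul_left (hconst _) _).trans_lt ?_
      rw [← WithZero.exp_add, WithZero.exp_lt_exp]
      omega
    have h0 : P.valuation (algebraMap k W.FunctionField W.a₆) < WithZero.exp (3 * a) :=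
      (hconst _).trans_lt (by rw [WithZero.exp_lt_exp]; omega)
    have e2 := (P.valuation.map_add_eq_of_lt_left (h2.trans_eq h3.symm)).trans h3
    have e1 := (P.valuation.map_add_eq_of_lt_left (h1.trans_eq e2.symm)).trans e2
    exact (P.valuation.map_add_eq_of_lt_left (h0.trans_eq e1.symm)).trans e1
  have hlin : P.valuation (algebraMap k _ W.a₁ * xFun W + algebraMap k _ W.a₃) ≤
      WithZero.exp a := by
    refine (P.valuation.map_add _ _).trans (max_le ?_ ?_)
    · rw [map_mul, ha]
      exact mul_le_of_le_one_left' (P.valuation_algebraMap_le _)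
    · exact (hconst _).trans (by rw [WithZero.exp_le_exp]; omega)
  rw [← weierstrass_equation, map_mul] at hcubic
  -- The product `y (y + a₁x + a₃)` has a pole of order `3a`, more than `2a`, so `y` dominates the
  -- linear term. Comparing orders gives `2b = 3a`, whence `a = 2c` and `b = 3c`.
  have hy : WithZero.exp a < P.valuation (yFun W) := by
    by_contra! hy
    have := mul_le_mul' hy ((P.valuation.map_add (yFun W) _).trans (max_le hy hlin))
    rw [hcubic, ← WithZero.exp_add, WithZero.exp_le_exp] at this
    omega
  rw [Valuation.map_add_eq_of_lt_left _ (hlin.trans_lt hy)] at hcubic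
  obtain ⟨b, hb⟩ : ∃ b : ℤ, P.valuation (yFun W) = WithZero.exp b :=
    ⟨_, (WithZero.exp_log (hy.trans_le' zero_le).ne').symm⟩
  rw [hb, ← WithZero.exp_add, WithZero.exp_inj] at hcubic
  obtain ⟨c, rfl⟩ : ∃ c, a = 2 * c := ⟨b - a, by omega⟩
  obtain rfl : b = 3 * c := by omega
  have hc : 0 < c := by omega
  have hle : ∀ (u : W.CoordinateRing) (n : ℕ), infinityValuation W u < WithZero.exp (n : ℤ) →
      P.valuation (algebraMap _ _ u) ≤ WithZero.exp (c * (n - 1)) := by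
    intro u n hu
    have hpoly : ∀ (p : k[X]) (m : ℤ), (∀ i : ℕ, m < 2 * i → p.coeff i = 0) →
        P.valuation (aeval (xFun W) p) ≤ WithZero.exp (c * m) := by
      intro p m hp
      rw [aeval_eq_sum_range]
      refine Valuation.map_sum_le _ fun i _ => ?_
      by_cases hi : m < 2 * i
      · rw [hp i hi, zero_smul, map_zero]
        exact zero_le
      · rw [Algebra.smul_def, map_mul, map_pow, ha, ← WithZero.exp_nsmul]
        refine (mul_le_mul_left (hconst _) _).trans ?_
        rw [← WithZero.exp_add, WithZero.exp_le_exp, nsmul_eq_mul]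
        nlinarith
    obtain ⟨p, q, rfl⟩ := exists_smul_basis_eq u
    rw [infinityValuation_lt_exp_iff] at hu
    rw [algebraMap_basis]
    refine (P.valuation.map_add _ _).trans (max_le ?_ ?_)
    · exact hpoly p _ fun i hi => hu.1 i (by omega)
    · rw [map_mul, hb]
      refine (mul_le_mul_left (hpoly q (n - 4) fun i hi => hu.2 i (by omega)) _).trans ?_
      rw [← WithZero.exp_add, WithZero.exp_le_exp]
      nlinarith
  -- Pole orders at infinity are never `1`, so each is `2i + 3j` for a monomial `XⁱYʲ`. Subtracting
  -- a constant multiple of it lowers the order, and `hle` shows that the remainder is also smaller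
  -- at `P`.
  have heq : ∀ u : W.CoordinateRing, u ≠ 0 → P.valuation (algebraMap _ _ u) =
      WithZero.exp (c * WithZero.log (infinityValuation W u)) := by
    intro u hu
    have hun := infinityValuation_of_ne_zero W hu
    have hn1 := natDegree_norm_ne_one u
    set n := (Algebra.norm k[X] u).natDegree
    obtain ⟨i, j, hij⟩ : ∃ i j : ℕ, n = 2 * i + 3 * j := by
      rcases Nat.even_or_odd' n with ⟨m, hm | hm⟩
      · exact ⟨m, 0, by omega⟩
      · exact ⟨m - 1, 1, by omega⟩
    set w := (algebraMap k[X] W.CoordinateRing X) ^ i * (mk W Y) ^ j with hw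
    have hwn : infinityValuation W w = WithZero.exp (n : ℤ) := by
      rw [hw, map_mul, map_pow, map_pow, infinityValuation_X, infinityValuation_Y,
        ← WithZero.exp_nsmul, ← WithZero.exp_nsmul, ← WithZero.exp_add, hij]
      simp [mul_comm]
    have hwP : P.valuation (algebraMap _ _ w) = WithZero.exp (c * n) := by
      rw [hw, map_mul, map_pow, map_pow, map_mul, map_pow, map_pow, ha, hb,
        ← WithZero.exp_nsmul, ← WithZero.exp_nsmul, ← WithZero.exp_add, hij]
      congr 1
      simp only [nsmul_eq_mul]
      push_cast
      ring
    have hw0 : w ≠ 0 := by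
      intro h
      rw [h, map_zero] at hwn
      exact WithZero.exp_ne_zero hwn.symm
    obtain ⟨d, hd⟩ := exists_infinityValuation_sub_lt W hw0 (hun.trans hwn.symm).le
    have hd0 : d ≠ 0 := by
      rintro rfl
      rw [map_zero, zero_mul, sub_zero, hun, hwn] at hd
      exact hd.false
    have h1 := hle _ n (hd.trans_eq hwn)
    have h2 : P.valuation (algebraMap _ W.FunctionField (algebraMap k _ d * w)) =
        WithZero.exp (c * n) := by
      rw [map_mul, map_mul, ← IsScalarTower.algebraMap_apply, P.trivial_on_base d hd0, one_mul, hwP]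
    have h3 : P.valuation (algebraMap _ W.FunctionField (u - algebraMap k _ d * w)) <
        P.valuation (algebraMap _ W.FunctionField (algebraMap k _ d * w)) := by
      rw [h2]
      refine h1.trans_lt ?_
      rw [WithZero.exp_lt_exp]
      nlinarith
    have h4 := P.valuation.map_add_eq_of_lt_right h3
    rw [← map_add, sub_add_cancel, h2] at h4
    rw [h4, hun, WithZero.log_exp]
  have heq' : ∀ f : W.FunctionField, f ≠ 0 → P.valuation f =
      WithZero.exp (c * WithZero.log ((infinityPlace W).valuation f)) := by
    intro f hf
    obtain ⟨u, w, hw, rfl⟩ := IsFractionRing.div_surjective (A := W.CoordinateRing) f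
    have hw0 : w ≠ 0 := nonZeroDivisors.ne_zero hw
    have hu0 : u ≠ 0 := by
      rintro rfl
      rw [map_zero, zero_div] at hf
      exact hf rfl
    rw [map_div₀, map_div₀, infinityPlace_algebraMap, infinityPlace_algebraMap, heq u hu0,
      heq w hw0, ← WithZero.exp_sub,
      WithZero.log_div (infinityValuation_ne_zero W hu0) (infinityValuation_ne_zero W hw0), mul_sub]
  -- Orders at `P` are now `c` times orders at infinity; normalization of `P` forces `c = 1`.
  obtain ⟨f, hf⟩ := P.surjective (WithZero.exp 1)
  have hf0 : f ≠ 0 := by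
    rintro rfl
    exact WithZero.exp_ne_zero (hf.symm.trans (map_zero _))
  have hc1 : c = 1 := by
    rw [heq' f hf0, WithZero.exp_inj] at hf
    exact (Int.eq_one_or_neg_one_of_mul_eq_one hf).resolve_right (by omega)
  refine Place.ext (Valuation.ext fun f => ?_)
  rcases eq_or_ne f 0 with rfl | hf0
  · simp
  · rw [heq' f hf0, hc1, one_mul, WithZero.exp_log]
    simpa using hf0

end CurveLB

/-! ### Affine places and maximal ideals of the coordinate ring. -/

namespace CurveLB

section PlaceGeneral

variable {k : Type*} {K : Type*} [Field k] [Field K] [Algebra k K]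

lemma Place.exists_valuation_eq_exp (P : Place k K) {f : K} (hf : f ≠ 0) :
    ∃ n : ℤ, P.valuation f = WithZero.exp n :=
  ⟨_, (WithZero.exp_log ((Valuation.ne_zero_iff _).mpr hf)).symm⟩

lemma le_exp_neg_one_of_lt_one {a : ℤᵐ⁰} (ha : a < 1) : a ≤ WithZero.exp (-1) := by
  rcases eq_or_ne a 0 with rfl | h
  · exact zero_le
  · rw [← WithZero.exp_log h, ← WithZero.exp_zero, WithZero.exp_lt_exp] at ha
    rw [← WithZero.exp_log h, WithZero.exp_le_exp]
    omega

/-- A place is determined by its local ring. -/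
lemma Place.eq_of_localRing_le {P Q : Place k K}
    (h : ∀ f, Q.valuation f ≤ 1 → P.valuation f ≤ 1) : P = Q := by
  have hunit : ∀ f, Q.valuation f = 1 → P.valuation f = 1 := by
    intro f hf
    refine le_antisymm (h f hf.le) ?_
    have h0 : P.valuation f ≠ 0 := by
      rw [Valuation.ne_zero_iff]
      rintro rfl
      simp at hf
    have := h f⁻¹ (by rw [map_inv₀, hf, inv_one])
    rwa [map_inv₀, inv_le_one₀ (zero_lt_iff.mpr h0)] at this
  obtain ⟨t, ht⟩ := Q.surjective (WithZero.exp 1)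
  have ht0 : t ≠ 0 := by
    rintro rfl
    exact WithZero.exp_ne_zero (ht.symm.trans (map_zero _))
  obtain ⟨c, hc⟩ := P.exists_valuation_eq_exp ht0
  -- Up to a unit at `Q`, hence at `P`, every function is a power of `t`; so orders at `P` are `c`
  -- times orders at `Q`, and normalization gives `c = 1`.
  have key : ∀ f : K, f ≠ 0 → ∀ m : ℤ, Q.valuation f = WithZero.exp m →
      P.valuation f = WithZero.exp (m * c) := by
    intro f hf m hm
    have h1 := hunit (f / t ^ m) (by
      rw [map_div₀, map_zpow₀, hm, ht, ← WithZero.exp_zsmul, smul_eq_mul, mul_one, div_self]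
      exact WithZero.exp_ne_zero)
    rw [map_div₀, map_zpow₀, hc, ← WithZero.exp_zsmul, smul_eq_mul, div_eq_one_iff_eq] at h1
    · exact h1
    · exact WithZero.exp_ne_zero
  have hc0 : 0 ≤ c := by
    have h1 := h t⁻¹ (by
      rw [map_inv₀, ht, ← WithZero.exp_neg, ← WithZero.exp_zero, WithZero.exp_le_exp]
      norm_num)
    rw [map_inv₀, hc, ← WithZero.exp_neg, ← WithZero.exp_zero, WithZero.exp_le_exp] at h1
    omega
  obtain ⟨f, hf⟩ := P.surjective (WithZero.exp 1)
  have hf0 : f ≠ 0 := by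
    rintro rfl
    exact WithZero.exp_ne_zero (hf.symm.trans (map_zero _))
  obtain ⟨m, hm⟩ := Q.exists_valuation_eq_exp hf0
  rw [key f hf0 m hm, WithZero.exp_inj] at hf
  have hc1 : c = 1 := (Int.eq_one_or_neg_one_of_mul_eq_one' hf).elim And.right fun h => by omega
  refine Place.ext (Valuation.ext fun f => ?_)
  rcases eq_or_ne f 0 with rfl | hf0
  · simp
  · obtain ⟨m, hm⟩ := Q.exists_valuation_eq_exp hf0
    rw [hm, key f hf0 m hm, hc1, mul_one]

end PlaceGeneral

open Polynomial WeierstrassCurve.Affine WeierstrassCurve.Affine.CoordinateRing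
open scoped Polynomial.Bivariate

variable {k : Type*} [Field k] {W : WeierstrassCurve.Affine k}

/-- The point of the curve corresponding to a maximal ideal of the affine coordinate ring. -/
noncomputable def affinePlace [W.IsElliptic]
    (v : IsDedekindDomain.HeightOneSpectrum W.CoordinateRing) : Place k W.FunctionField where
  valuation := v.valuation W.FunctionField
  surjective := v.valuation_surjective W.FunctionField
  trivial_on_base c hc := by
    rw [IsScalarTower.algebraMap_apply k W.CoordinateRing W.FunctionField]
    refine le_antisymm (v.valuation_le_one _) ?_
    have h : v.valuation W.FunctionField (algebraMap _ _ (algebraMap k W.CoordinateRing c⁻¹)) ≤ 1 :=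
      v.valuation_le_one _
    have h1 : algebraMap W.CoordinateRing W.FunctionField (algebraMap k W.CoordinateRing c⁻¹) =
        (algebraMap W.CoordinateRing W.FunctionField (algebraMap k W.CoordinateRing c))⁻¹ := by
      rw [← IsScalarTower.algebraMap_apply, ← IsScalarTower.algebraMap_apply, map_inv₀]
    rw [h1, map_inv₀, inv_le_one₀] at h
    · exact h
    · rw [zero_lt_iff, Valuation.ne_zero_iff, ← IsScalarTower.algebraMap_apply]
      simpa using hc

lemma valuation_xFun_le_one {P : Place k W.FunctionField} (hP : P ≠ infinityPlace W) :
    P.valuation (xFun W) ≤ 1 := by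
  by_contra h
  exact hP (eq_infinityPlace W h)

lemma valuation_coordinateRing_le_one {P : Place k W.FunctionField} (hP : P ≠ infinityPlace W)
    (u : W.CoordinateRing) : P.valuation (algebraMap _ _ u) ≤ 1 :=
  valuation_algebraMap_le_one W (valuation_xFun_le_one hP) u

lemma affinePlace_ne_infinityPlace [W.IsElliptic]
    (v : IsDedekindDomain.HeightOneSpectrum W.CoordinateRing) :
    affinePlace v ≠ infinityPlace W := by
  intro h
  have h1 : (affinePlace v).valuation (xFun W) ≤ 1 := v.valuation_le_one _
  rw [h, infinityPlace_xFun, ← WithZero.exp_zero, WithZero.exp_le_exp] at h1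
  norm_num at h1

/-- Functions without poles on the affine curve are polynomial functions. -/
lemma exists_algebraMap_eq [W.IsElliptic] {f : W.FunctionField}
    (hf : ∀ P : Place k W.FunctionField, P ≠ infinityPlace W → P.valuation f ≤ 1) :
    ∃ u : W.CoordinateRing, algebraMap _ _ u = f :=
  IsDedekindDomain.HeightOneSpectrum.mem_integers_of_valuation_le_one _ f
    fun v => hf (affinePlace v) (affinePlace_ne_infinityPlace v)

/-- Otherwise the valuation would be trivial on all fractions, contradicting its surjectivity. This
makes the center of `P` a nonzero prime. -/
lemma exists_valuation_lt_one {P : Place k W.FunctionField} (hP : P ≠ infinityPlace W) :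
    ∃ u : W.CoordinateRing, u ≠ 0 ∧ P.valuation (algebraMap _ _ u) < 1 := by
  by_contra! h
  have h1 : ∀ u : W.CoordinateRing, u ≠ 0 → P.valuation (algebraMap _ _ u) = 1 :=
    fun u hu => le_antisymm (valuation_coordinateRing_le_one hP u) (h u hu)
  obtain ⟨f, hf⟩ := P.surjective (WithZero.exp 1)
  obtain ⟨u, w, hw, rfl⟩ := IsFractionRing.div_surjective (A := W.CoordinateRing) f
  have hu : u ≠ 0 := by
    rintro rfl
    rw [map_zero, zero_div, map_zero] at hf
    exact WithZero.exp_ne_zero hf.symm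
  rw [map_div₀, h1 u hu, h1 w (nonZeroDivisors.ne_zero hw), div_one, ← WithZero.exp_zero,
    WithZero.exp_inj] at hf
  norm_num at hf

/-- The maximal ideal of the affine coordinate ring corresponding to an affine point. -/
noncomputable def center {P : Place k W.FunctionField} (hP : P ≠ infinityPlace W) :
    IsDedekindDomain.HeightOneSpectrum W.CoordinateRing where
  asIdeal :=
    { carrier := {u | P.valuation (algebraMap _ _ u) < 1}
      zero_mem' := by simp
      add_mem' := fun {u w} hu hw => by
        have h1 : P.valuation (algebraMap _ _ u) < 1 := hu
        have h2 : P.valuation (algebraMap _ _ w) < 1 := hw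
        simpa using P.valuation.map_add_lt h1 h2
      smul_mem' := fun u w hw => by
        have h2 : P.valuation (algebraMap _ _ w) < 1 := hw
        simpa using mul_lt_one_of_nonneg_of_lt_one_right
          (valuation_coordinateRing_le_one hP u) zero_le h2 }
  isPrime := by
    refine ⟨fun h => ?_, fun {u w} huw => ?_⟩
    · have : (1 : W.CoordinateRing) ∈ (⊤ : Ideal W.CoordinateRing) := trivial
      rw [← h] at this
      have h1 : P.valuation (algebraMap _ _ (1 : W.CoordinateRing)) < 1 := this
      simp at h1
    · have h1 : P.valuation (algebraMap _ _ (u * w)) < 1 := huw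
      rw [map_mul, map_mul] at h1
      by_contra! h
      have hu : 1 ≤ P.valuation (algebraMap _ _ u) := not_lt.mp h.1
      have hw : 1 ≤ P.valuation (algebraMap _ _ w) := not_lt.mp h.2
      exact absurd h1 (not_lt.mpr (one_le_mul hu hw))
  ne_bot := by
    obtain ⟨u, hu, h⟩ := exists_valuation_lt_one hP
    intro hbot
    have : u ∈ (⊥ : Ideal W.CoordinateRing) := by
      rw [← hbot]
      exact h
    exact hu this

lemma mem_center {P : Place k W.FunctionField} (hP : P ≠ infinityPlace W) {u : W.CoordinateRing} :
    u ∈ (center hP).asIdeal ↔ P.valuation (algebraMap _ _ u) < 1 := Iff.rfl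

lemma notMem_center {P : Place k W.FunctionField} (hP : P ≠ infinityPlace W)
    {u : W.CoordinateRing} :
    u ∉ (center hP).asIdeal ↔ P.valuation (algebraMap _ _ u) = 1 := by
  rw [mem_center, not_lt]
  exact ⟨fun h => le_antisymm (valuation_coordinateRing_le_one hP u) h, fun h => h.ge⟩

/-- Functions regular at an affine point are fractions with denominator not vanishing there. -/
lemma exists_mul_eq_of_valuation_le_one [W.IsElliptic] {P : Place k W.FunctionField}
    (hP : P ≠ infinityPlace W) {f : W.FunctionField} (hf : P.valuation f ≤ 1) :
    ∃ a s : W.CoordinateRing, P.valuation (algebraMap _ _ s) = 1 ∧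
      f * algebraMap _ _ s = algebraMap _ _ a := by
  obtain ⟨n, d, h | h⟩ := (center hP).exists_primeCompl_mul_eq_or_mul_eq f
  · exact ⟨n, d, (notMem_center hP).mp d.2, h⟩
  · refine ⟨d, n, ?_, h⟩
    have h1 := congrArg P.valuation h
    rw [map_mul, (notMem_center hP).mp d.2] at h1
    refine le_antisymm (valuation_coordinateRing_le_one hP n) ?_
    by_contra! h2
    exact absurd h1 (mul_lt_one_of_nonneg_of_lt_one_right hf zero_le h2).ne

/-- The residue field at an affine point is a quotient of the affine coordinate ring. -/
lemma exists_valuation_sub_lt_one [W.IsElliptic] {P : Place k W.FunctionField}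
    (hP : P ≠ infinityPlace W) {f : W.FunctionField} (hf : P.valuation f ≤ 1) :
    ∃ u : W.CoordinateRing, P.valuation (f - algebraMap _ _ u) < 1 := by
  obtain ⟨a, s, hs, h⟩ := exists_mul_eq_of_valuation_le_one hP hf
  have hmax := (center hP).isMaximal
  -- With `t` an inverse of `s` modulo the center, `f = a/s` is congruent to `a t`.
  obtain ⟨t, ht⟩ := hmax.exists_inv ((notMem_center hP).mpr hs)
  refine ⟨a * t, ?_⟩
  obtain ⟨i, hi, hti⟩ := ht
  have hi' : P.valuation (algebraMap _ _ i) < 1 := hi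
  have : f - algebraMap _ _ (a * t) = f * algebraMap _ _ i := by
    have h2 := congrArg (algebraMap W.CoordinateRing W.FunctionField) hti
    rw [map_add, map_mul, map_one] at h2
    rw [map_mul, ← h]
    linear_combination (-f) * h2
  rw [this, map_mul]
  exact mul_lt_one_of_nonneg_of_lt_one_right hf zero_le hi'

lemma finite_quotient_span {a : W.CoordinateRing} (ha : a ≠ 0) :
    Module.Finite k (W.CoordinateRing ⧸ Ideal.span {a}) := by
  have h := Ideal.span_singleton_eq_bot.not.2 ha
  exact Module.Finite.equiv
    (Ideal.quotientEquivDirectSum k (CoordinateRing.basis W) h).symm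

end CurveLB

/-! ### Residue fields, and the codimension of functions vanishing on an affine divisor. -/

namespace CurveLB

lemma Place.finite_of_deg_pos {k K : Type*} [Field k] [Field K] [Algebra k K] {P : Place k K}
    (h : 0 < P.deg) : Module.Finite k (P.localRing ⧸ P.maximalIdeal) :=
  FiniteDimensional.of_finrank_pos h

open Polynomial WeierstrassCurve.Affine WeierstrassCurve.Affine.CoordinateRing
open scoped Polynomial.Bivariate

variable {k : Type*} [Field k] {W : WeierstrassCurve.Affine k}

/-- The evaluation map from the affine coordinate ring to the residue field of an affine point. -/
noncomputable def residueMap {P : Place k W.FunctionField} (hP : P ≠ infinityPlace W) :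
    W.CoordinateRing →ₐ[k] P.localRing ⧸ P.maximalIdeal :=
  (Ideal.Quotient.mkₐ k P.maximalIdeal).comp
    ((IsScalarTower.toAlgHom k W.CoordinateRing W.FunctionField).codRestrict P.localRing
      (valuation_coordinateRing_le_one hP))

lemma residueMap_eq_zero {P : Place k W.FunctionField} (hP : P ≠ infinityPlace W)
    {u : W.CoordinateRing} : residueMap hP u = 0 ↔ P.valuation (algebraMap _ _ u) < 1 :=
  Ideal.Quotient.eq_zero_iff_mem

lemma residueMap_surjective [W.IsElliptic] {P : Place k W.FunctionField}
    (hP : P ≠ infinityPlace W) : Function.Surjective (residueMap hP) := by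
  intro x
  obtain ⟨⟨f, hf⟩, rfl⟩ := Ideal.Quotient.mk_surjective x
  obtain ⟨u, hu⟩ := exists_valuation_sub_lt_one hP hf
  exact ⟨u, (Ideal.Quotient.eq.mpr hu).symm⟩

lemma finite_quotient_of_mem {J : Ideal W.CoordinateRing} {a : W.CoordinateRing} (ha : a ≠ 0)
    (haJ : a ∈ J) : Module.Finite k (W.CoordinateRing ⧸ J) := by
  have := finite_quotient_span (k := k) ha
  exact Module.Finite.of_surjective
    (Ideal.Quotient.factorₐ k ((Ideal.span_singleton_le_iff_mem J).mpr haJ)).toLinearMap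
    (Ideal.Quotient.factor_surjective ((Ideal.span_singleton_le_iff_mem J).mpr haJ))

lemma finite_residueField [W.IsElliptic] (P : Place k W.FunctionField) :
    Module.Finite k (P.localRing ⧸ P.maximalIdeal) := by
  by_cases hP : P = infinityPlace W
  · exact Place.finite_of_deg_pos (by rw [hP, infinityPlace_deg]; exact one_pos)
  · obtain ⟨a, ha, h⟩ := exists_valuation_lt_one hP
    have := finite_quotient_of_mem (k := k) (J := RingHom.ker (residueMap hP)) ha
      ((residueMap_eq_zero hP).mpr h)
    exact Module.Finite.equiv
      (Ideal.quotientKerAlgEquivOfSurjective (residueMap_surjective hP)).toLinearEquiv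

lemma deg_pos [W.IsElliptic] (P : Place k W.FunctionField) : 0 < P.deg := by
  have := finite_residueField P
  exact Module.finrank_pos

lemma exists_uniformizer [W.IsElliptic] {P : Place k W.FunctionField}
    (hP : P ≠ infinityPlace W) :
    ∃ t : W.CoordinateRing, P.valuation (algebraMap _ _ t) = WithZero.exp (-1) := by
  obtain ⟨f, hf⟩ := P.surjective (WithZero.exp (-1))
  obtain ⟨a, s, hs, h⟩ := exists_mul_eq_of_valuation_le_one hP (f := f) (by
    rw [hf, ← WithZero.exp_zero, WithZero.exp_le_exp]
    norm_num)
  exact ⟨a, by rw [← h, map_mul, hs, hf, mul_one]⟩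

/-- Distinct affine points are separated by polynomial functions. -/
lemma exists_separating [W.IsElliptic] {P Q : Place k W.FunctionField}
    (hP : P ≠ infinityPlace W) (hQ : Q ≠ infinityPlace W) (h : Q ≠ P) :
    ∃ u : W.CoordinateRing,
      Q.valuation (algebraMap _ _ u) < 1 ∧ P.valuation (algebraMap _ _ u) = 1 := by
  by_contra! hne
  have hle : (center hQ).asIdeal ≤ (center hP).asIdeal := fun u hu => by
    rw [mem_center]
    exact lt_of_le_of_ne (valuation_coordinateRing_le_one hP u) (hne u hu)
  have heq := (center hQ).isMaximal.eq_of_le (center hP).isPrime.ne_top hle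
  refine h (Place.eq_of_localRing_le fun f hf => ?_).symm
  obtain ⟨a, s, hs, hfs⟩ := exists_mul_eq_of_valuation_le_one hQ hf
  have hs' : P.valuation (algebraMap _ _ s) = 1 := by
    rw [← notMem_center hP, ← heq, notMem_center]
    exact hs
  have := congrArg P.valuation hfs
  rw [map_mul, hs', mul_one] at this
  rw [this]
  exact valuation_coordinateRing_le_one hP a

open Classical in
/-- Polynomial functions vanishing at an effective affine divisor, given as a multiset. -/
noncomputable def vanishingIdeal (E : Multiset (Place k W.FunctionField)) :
    Ideal W.CoordinateRing where
  carrier := {u | ∀ P, P ≠ infinityPlace W →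
    P.valuation (algebraMap _ _ u) ≤ WithZero.exp (-(E.count P : ℤ))}
  zero_mem' P _ := by simp
  add_mem' {u w} hu hw P hP := by
    rw [map_add]
    exact (P.valuation.map_add _ _).trans (max_le (hu P hP) (hw P hP))
  smul_mem' u w hw P hP := by
    rw [smul_eq_mul, map_mul, map_mul]
    exact (mul_le_of_le_one_left' (valuation_coordinateRing_le_one hP u)).trans (hw P hP)

-- The function is a product over `E`: a uniformizer at `P` for each occurrence of `P`, and for each
-- other point a function vanishing there but not at `P`. It generates the vanishing ideal locally
-- at `P`.
open Classical in
lemma exists_mem_vanishingIdeal [W.IsElliptic] {P : Place k W.FunctionField}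
    (hP : P ≠ infinityPlace W) (E : Multiset (Place k W.FunctionField)) :
    (∀ Q ∈ E, Q ≠ infinityPlace W) → ∃ g ∈ vanishingIdeal E,
      P.valuation (algebraMap _ _ g) = WithZero.exp (-(E.count P : ℤ)) := by
  induction E using Multiset.induction with
  | empty =>
    intro _
    refine ⟨1, fun Q hQ => ?_, ?_⟩
    · simp
    · simp
  | cons Q E ih =>
    intro hE
    have hQ := hE Q (Multiset.mem_cons_self _ _)
    obtain ⟨g, hg, hgP⟩ := ih fun R hR => hE R (Multiset.mem_cons_of_mem hR)
    obtain ⟨b, hb, hbP⟩ : ∃ b : W.CoordinateRing, Q.valuation (algebraMap _ _ b) < 1 ∧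
        P.valuation (algebraMap _ _ b) = WithZero.exp (if P = Q then -1 else 0) := by
      by_cases h : P = Q
      · obtain ⟨t, ht⟩ := exists_uniformizer hP
        refine ⟨t, ?_, by rw [if_pos h, ht]⟩
        rw [← h, ht, ← WithZero.exp_zero, WithZero.exp_lt_exp]
        norm_num
      · obtain ⟨t, ht, ht'⟩ := exists_separating hP hQ (Ne.symm h)
        exact ⟨t, ht, by rw [if_neg h, ht', WithZero.exp_zero]⟩
    refine ⟨b * g, fun R hR => ?_, ?_⟩
    · rw [map_mul, map_mul, Multiset.count_cons, Nat.cast_add, neg_add, add_comm,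
        WithZero.exp_add]
      refine mul_le_mul' ?_ (hg R hR)
      by_cases h : R = Q
      · rw [if_pos h, h]
        exact le_exp_neg_one_of_lt_one hb
      · rw [if_neg h]
        simpa using valuation_coordinateRing_le_one hR b
    · rw [map_mul, map_mul, Multiset.count_cons, Nat.cast_add, neg_add, add_comm,
        WithZero.exp_add, hgP, hbP]
      congr 2
      split_ifs <;> simp

lemma exists_ne_zero_mem_vanishingIdeal [W.IsElliptic] (E : Multiset (Place k W.FunctionField))
    (hE : ∀ Q ∈ E, Q ≠ infinityPlace W) : ∃ g ∈ vanishingIdeal E, g ≠ 0 := by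
  by_cases h : ∃ P : Place k W.FunctionField, P ≠ infinityPlace W
  · obtain ⟨P, hP⟩ := h
    obtain ⟨g, hg, hgP⟩ := exists_mem_vanishingIdeal hP E hE
    refine ⟨g, hg, ?_⟩
    rintro rfl
    rw [map_zero, map_zero] at hgP
    exact WithZero.exp_ne_zero hgP.symm
  · push Not at h
    exact ⟨1, fun P hP => absurd (h P) hP, one_ne_zero⟩

lemma finite_quotient_vanishingIdeal [W.IsElliptic] (E : Multiset (Place k W.FunctionField))
    (hE : ∀ Q ∈ E, Q ≠ infinityPlace W) :
    Module.Finite k (W.CoordinateRing ⧸ vanishingIdeal E) :=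
  have ⟨_, hg, hg0⟩ := exists_ne_zero_mem_vanishingIdeal E hE
  finite_quotient_of_mem hg0 hg

/-- Induction on `E`. If `g` generates the vanishing ideal of `E` at `P`, multiplication by `g`
embeds the residue field of `P` into the kernel of the projection from the quotient for `P + E` to
that for `E`, so the dimension grows by at least `deg P`. -/
lemma sum_deg_le_finrank [W.IsElliptic] (E : Multiset (Place k W.FunctionField)) :
    (∀ Q ∈ E, Q ≠ infinityPlace W) →
      (E.map Place.deg).sum ≤ Module.finrank k (W.CoordinateRing ⧸ vanishingIdeal E) := by
  classical
  induction E using Multiset.induction with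
  | empty => simp
  | cons P E ih =>
    intro hPE
    have hP := hPE P (Multiset.mem_cons_self _ _)
    have hE : ∀ Q ∈ E, Q ≠ infinityPlace W := fun R hR => hPE R (Multiset.mem_cons_of_mem hR)
    have hfin := finite_quotient_vanishingIdeal (k := k) _ hPE
    have hle : vanishingIdeal (P ::ₘ E) ≤ vanishingIdeal E := fun u hu Q hQ =>
      (hu Q hQ).trans (by
        rw [WithZero.exp_le_exp, neg_le_neg_iff, Nat.cast_le]
        exact Multiset.count_le_count_cons _ _ _)
    obtain ⟨g, hg, hgP⟩ := exists_mem_vanishingIdeal hP E hE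
    let π := (Ideal.Quotient.factorₐ k hle).toLinearMap
    let ψ : W.CoordinateRing →ₗ[k] W.CoordinateRing ⧸ vanishingIdeal (P ::ₘ E) :=
      (Ideal.Quotient.mkₐ k _).toLinearMap ∘ₗ LinearMap.mulLeft k g
    have hψker : LinearMap.ker ψ = LinearMap.ker (residueMap hP).toLinearMap := by
      ext u
      rw [LinearMap.mem_ker, LinearMap.mem_ker, AlgHom.toLinearMap_apply, residueMap_eq_zero]
      change Ideal.Quotient.mk _ (g * u) = 0 ↔ _
      rw [Ideal.Quotient.eq_zero_iff_mem]
      constructor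
      · intro h
        have h1 := h P hP
        rw [map_mul, map_mul, hgP, Multiset.count_cons_self, Nat.cast_add, neg_add,
          WithZero.exp_add] at h1
        refine (le_of_mul_le_mul_left h1 WithZero.exp_pos).trans_lt ?_
        rw [← WithZero.exp_zero, WithZero.exp_lt_exp]
        norm_num
      · intro h Q hQ
        rw [map_mul, map_mul]
        by_cases hQP : Q = P
        · rw [hQP, hgP, Multiset.count_cons_self, Nat.cast_add, neg_add, WithZero.exp_add]
          exact mul_le_mul' le_rfl (le_exp_neg_one_of_lt_one h)
        · rw [Multiset.count_cons_of_ne hQP]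
          exact (mul_le_of_le_one_right' (valuation_coordinateRing_le_one hQ u)).trans (hg Q hQ)
    have hψ : LinearMap.range ψ ≤ LinearMap.ker π := by
      rintro _ ⟨u, rfl⟩
      change Ideal.Quotient.mk _ (g * u) = 0
      rw [Ideal.Quotient.eq_zero_iff_mem]
      exact Ideal.mul_mem_right _ _ hg
    have h1 : P.deg = Module.finrank k (LinearMap.range ψ) := by
      rw [← ψ.quotKerEquivRange.finrank_eq, hψker]
      exact (LinearMap.quotKerEquivOfSurjective (residueMap hP).toLinearMap
        (residueMap_surjective hP)).finrank_eq.symm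
    have h2 := Submodule.finrank_mono hψ
    have h3 := π.finrank_range_add_finrank_ker
    rw [LinearMap.range_eq_top.mpr (Ideal.Quotient.factor_surjective hle), finrank_top] at h3
    rw [Multiset.map_cons, Multiset.sum_cons]
    have := ih hE
    omega

end CurveLB

/-! ### Dimensions of spaces of sections under adding and removing points. -/

namespace CurveLB

section LinearAlgebra

variable {k V V' : Type*} [Field k] [AddCommGroup V] [Module k V] [AddCommGroup V'] [Module k V']

lemma finite_of_finite_ker (f : V →ₗ[k] V') (hV' : Module.Finite k V')
    (h : Module.Finite k (LinearMap.ker f)) : Module.Finite k V :=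
  have : Module.Finite k (V ⧸ LinearMap.ker f) := Module.Finite.equiv f.quotKerEquivRange.symm
  Module.Finite.of_submodule_quotient (LinearMap.ker f)

lemma finrank_le_finrank_ker_add (f : V →ₗ[k] V') (hV' : Module.Finite k V')
    (h : Module.Finite k V) :
    Module.finrank k V ≤ Module.finrank k (LinearMap.ker f) + Module.finrank k V' := by
  have h1 := f.finrank_range_add_finrank_ker
  have h2 := Submodule.finrank_le (LinearMap.range f)
  omega

end LinearAlgebra

section Divisors

variable {k : Type*} {K : Type*} [Field k] [Field K] [Algebra k K]

lemma Div.deg_single (P : Place k K) (n : ℤ) : Div.deg (Finsupp.single P n) = n * P.deg := by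
  simp [Div.deg]

lemma H0_mono {D D' : Div k K} (h : D ≤ D') : H0 D ≤ H0 D' := fun _ hf P =>
  (hf P).trans (WithZero.exp_le_exp.mpr (h P))

lemma mul_mem_H0 {D D' : Div k K} {f g : K} (hf : f ∈ H0 D) (hg : g ∈ H0 D') :
    f * g ∈ H0 (D + D') := fun P => by
  rw [map_mul, Finsupp.add_apply, WithZero.exp_add]
  exact mul_le_mul' (hf P) (hg P)

lemma pow_mem_H0 {D : Div k K} {f : K} (hf : f ∈ H0 D) (n : ℕ) : f ^ n ∈ H0 (n • D) := fun P => by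
  rw [map_pow, Finsupp.smul_apply, WithZero.exp_nsmul]
  exact pow_le_pow_left' (hf P) n

lemma IsDivOf.valuation_eq {D : Div k K} {f : K} (h : IsDivOf D f) (P : Place k K) :
    P.valuation f = WithZero.exp (-D P) := by
  rw [h.2 P, Place.ord, neg_neg, WithZero.exp_log]
  exact (Valuation.ne_zero_iff _).mpr h.1

lemma isDivOf_of_valuation_eq {D : Div k K} {f : K} (hf : f ≠ 0)
    (h : ∀ P : Place k K, P.valuation f = WithZero.exp (-D P)) : IsDivOf D f :=
  ⟨hf, fun P => by rw [Place.ord, h, WithZero.log_exp, neg_neg]⟩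

/-- The effective divisor attached to a multiset of points. -/
noncomputable def multisetDiv (E : Multiset (Place k K)) : Div k K :=
  (E.map fun P => Finsupp.single P 1).sum

lemma multisetDiv_zero : multisetDiv (0 : Multiset (Place k K)) = 0 := rfl

lemma multisetDiv_cons (P : Place k K) (E : Multiset (Place k K)) :
    multisetDiv (P ::ₘ E) = Finsupp.single P 1 + multisetDiv E := by
  simp [multisetDiv]

open Classical in
lemma multisetDiv_apply (E : Multiset (Place k K)) (P : Place k K) :
    multisetDiv E P = E.count P := by
  induction E using Multiset.induction with
  | empty => simp [multisetDiv]
  | cons Q E ih =>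
    rw [multisetDiv_cons, Finsupp.add_apply, ih, Multiset.count_cons, Finsupp.single_apply]
    split_ifs with h1 h2 h2
    · push_cast; ring
    · exact absurd h1.symm h2
    · exact absurd h2.symm h1
    · simp

lemma deg_multisetDiv (E : Multiset (Place k K)) :
    Div.deg (multisetDiv E) = (E.map Place.deg).sum := by
  induction E using Multiset.induction with
  | empty => simp [multisetDiv]
  | cons Q E ih => rw [multisetDiv_cons, map_add, ih, Div.deg_single]; simp

lemma exists_multisetDiv_eq {D : Div k K} (hD : 0 ≤ D) :
    ∃ E : Multiset (Place k K), multisetDiv E = D := by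
  classical
  refine ⟨Finsupp.toMultiset (D.mapRange Int.toNat rfl), ?_⟩
  ext P
  rw [multisetDiv_apply, Finsupp.count_toMultiset, Finsupp.mapRange_apply]
  exact Int.toNat_of_nonneg (hD P)

lemma exists_add_multisetDiv_eq {D D' : Div k K} (h : D ≤ D') :
    ∃ E : Multiset (Place k K), D' = multisetDiv E + D := by
  obtain ⟨E, hE⟩ := exists_multisetDiv_eq (sub_nonneg.mpr h)
  exact ⟨E, by rw [hE, sub_add_cancel]⟩

/-- A section of `𝒪(D)` that vanishes at `P` is a section of `𝒪(D - P)`. -/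
lemma mem_H0_sub_single {D : Div k K} {f : K} (hf : f ∈ H0 D) {P : Place k K}
    (hlt : P.valuation f < WithZero.exp (D P)) : f ∈ H0 (D - Finsupp.single P 1) := by
  intro Q
  by_cases hQ : Q = P
  · subst hQ
    rw [Finsupp.sub_apply, Finsupp.single_eq_same, sub_eq_add_neg, WithZero.exp_add]
    rw [← inv_mul_lt_one₀ WithZero.exp_pos] at hlt
    have := mul_le_mul' (le_refl (WithZero.exp (D Q))) (le_exp_neg_one_of_lt_one hlt)
    rwa [mul_inv_cancel_left₀ WithZero.exp_ne_zero] at this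
  · rw [Finsupp.sub_apply, Finsupp.single_eq_of_ne hQ, sub_zero]
    exact hf Q

/-- The leading coefficient at `P` of a section of `𝒪(D)`, with values in the residue field at `P`,
with respect to a function `t` that generates `𝒪(-D)` at `P`. -/
noncomputable def leadingCoeffAt {D : Div k K} {P : Place k K} {t : K}
    (ht : P.valuation t = WithZero.exp (-D P)) : H0 D →ₗ[k] P.localRing ⧸ P.maximalIdeal :=
  (Ideal.Quotient.mkₐ k P.maximalIdeal).toLinearMap ∘ₗ
    { toFun := fun f => (⟨t * (f : K), by
        rw [Place.mem_localRing, map_mul, ht]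
        refine (mul_le_mul' le_rfl (f.2 P)).trans ?_
        rw [← WithZero.exp_add, neg_add_cancel, WithZero.exp_zero]⟩ : P.localRing)
      map_add' := fun f g => Subtype.ext (by simp [mul_add])
      map_smul' := fun c f => Subtype.ext (by simp) }

lemma leadingCoeffAt_eq_zero {D : Div k K} {P : Place k K} {t : K}
    (ht : P.valuation t = WithZero.exp (-D P)) (f : H0 D) :
    leadingCoeffAt ht f = 0 ↔ (f : K) ∈ H0 (D - Finsupp.single P 1) := by
  have h : leadingCoeffAt ht f = 0 ↔ P.valuation (t * (f : K)) < 1 :=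
    Ideal.Quotient.eq_zero_iff_mem
  rw [h, map_mul, ht, WithZero.exp_neg, inv_mul_lt_one₀ WithZero.exp_pos]
  refine ⟨fun hlt => mem_H0_sub_single f.2 hlt, ?_⟩
  intro hmem
  refine (hmem P).trans_lt ?_
  rw [Finsupp.sub_apply, Finsupp.single_eq_same, WithZero.exp_lt_exp]
  omega

lemma exists_valuation_eq_exp (P : Place k K) (n : ℤ) :
    ∃ t : K, P.valuation t = WithZero.exp n := P.surjective _

lemma ker_leadingCoeffAt {D : Div k K} {P : Place k K} {t : K}
    (ht : P.valuation t = WithZero.exp (-D P)) :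
    LinearMap.ker (leadingCoeffAt ht) =
      (H0 (D - Finsupp.single P 1)).comap (H0 D).subtype := by
  ext f
  rw [LinearMap.mem_ker, leadingCoeffAt_eq_zero]
  rfl

lemma sub_single_le (D : Div k K) (P : Place k K) : D - Finsupp.single P 1 ≤ D := by
  rw [sub_le_self_iff]
  exact Finsupp.single_nonneg.mpr zero_le_one

lemma finite_H0_of_sub_single {D : Div k K} {P : Place k K} (hP : 0 < P.deg)
    (h : Module.Finite k (H0 (D - Finsupp.single P 1))) : Module.Finite k (H0 D) := by
  obtain ⟨t, ht⟩ := exists_valuation_eq_exp P (-D P)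
  refine finite_of_finite_ker (leadingCoeffAt ht) (Place.finite_of_deg_pos hP) ?_
  rw [ker_leadingCoeffAt]
  exact Module.Finite.equiv (Submodule.comapSubtypeEquivOfLe (H0_mono (sub_single_le D P))).symm

lemma finrank_H0_le_sub_single_add {D : Div k K} {P : Place k K} (hP : 0 < P.deg)
    (h : Module.Finite k (H0 D)) :
    Module.finrank k (H0 D) ≤ Module.finrank k (H0 (D - Finsupp.single P 1)) + P.deg := by
  obtain ⟨t, ht⟩ := exists_valuation_eq_exp P (-D P)
  have h1 := finrank_le_finrank_ker_add (leadingCoeffAt ht) (Place.finite_of_deg_pos hP) h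
  rwa [ker_leadingCoeffAt,
    (Submodule.comapSubtypeEquivOfLe (H0_mono (sub_single_le D P))).finrank_eq] at h1

lemma finite_H0_of_finite_H0_zero (hdeg : ∀ P : Place k K, 0 < P.deg)
    (h0 : Module.Finite k (H0 (0 : Div k K))) (D : Div k K) : Module.Finite k (H0 D) := by
  have key : ∀ E : Multiset (Place k K), Module.Finite k (H0 (multisetDiv E)) := by
    intro E
    induction E using Multiset.induction with
    | empty => rwa [multisetDiv_zero]
    | cons P E ih =>
      refine finite_H0_of_sub_single (hdeg P) (P := P) ?_
      rwa [multisetDiv_cons, add_sub_cancel_left]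
  obtain ⟨E, hE⟩ := exists_multisetDiv_eq (D := D ⊔ 0) le_sup_right
  have := key E
  rw [hE] at this
  exact Submodule.finiteDimensional_of_le (S₂ := H0 (D ⊔ 0)) (H0_mono le_sup_left)

/-- Each added point raises `h⁰` by at most its degree. Hence Riemann's inequality for a divisor
implies it for every smaller one. -/
lemma finrank_H0_sub_deg_mono (hdeg : ∀ P : Place k K, 0 < P.deg)
    (h0 : Module.Finite k (H0 (0 : Div k K))) {D D' : Div k K} (h : D ≤ D') :
    (Module.finrank k (H0 D') : ℤ) - D'.deg ≤ Module.finrank k (H0 D) - D.deg := by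
  obtain ⟨E, rfl⟩ := exists_add_multisetDiv_eq h
  clear h
  induction E using Multiset.induction with
  | empty => rw [multisetDiv_zero, zero_add]
  | cons P E ih =>
    have h1 := finrank_H0_le_sub_single_add (hdeg P) (finite_H0_of_finite_H0_zero hdeg h0
      (multisetDiv (P ::ₘ E) + D))
    have h2 : multisetDiv (P ::ₘ E) + D - Finsupp.single P 1 = multisetDiv E + D := by
      rw [multisetDiv_cons]
      abel
    have h3 : Div.deg (multisetDiv (P ::ₘ E) + D) = P.deg + Div.deg (multisetDiv E + D) := by
      rw [multisetDiv_cons, add_assoc, map_add, Div.deg_single, one_mul]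
    rw [h2] at h1
    rw [h3]
    omega

lemma finrank_H0_le_of_mul_mem {D D' : Div k K} (hfin : Module.Finite k (H0 D')) {h : K}
    (hh : h ≠ 0) (hmul : ∀ g ∈ H0 D, h * g ∈ H0 D') :
    Module.finrank k (H0 D) ≤ Module.finrank k (H0 D') := by
  refine LinearMap.finrank_le_finrank_of_injective
    (f := (LinearMap.mulLeft k h).restrict hmul) fun f g hfg => ?_
  have := congrArg Subtype.val hfg
  exact Subtype.ext (mul_left_cancel₀ hh this)

end Divisors

end CurveLB

/-! ### Riemann's inequality for a Weierstrass curve. -/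

namespace CurveLB

/-- The consequences of the Riemann–Roch theorem on a curve of genus one from which the other facts
about line bundles are derived. -/
structure RiemannInequality (k K : Type*) [Field k] [Field K] [Algebra k K] : Prop where
  deg_pos : ∀ P : Place k K, 0 < P.deg
  exists_algebraMap_eq : ∀ f ∈ H0 (0 : Div k K), ∃ c : k, algebraMap k K c = f
  deg_le : ∀ D : Div k K, D.deg ≤ Module.finrank k (H0 D)

open Polynomial WeierstrassCurve.Affine WeierstrassCurve.Affine.CoordinateRing
open scoped Polynomial.Bivariate

variable {k : Type*} [Field k] {W : WeierstrassCurve.Affine k}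

lemma exists_algebraMap_eq_of_mem_H0_zero [W.IsElliptic] {f : W.FunctionField}
    (hf : f ∈ H0 (0 : Div k W.FunctionField)) : ∃ c : k, algebraMap k _ c = f := by
  obtain ⟨u, rfl⟩ := exists_algebraMap_eq (f := f) fun P _ => hf P
  have h := hf (infinityPlace W)
  rw [infinityPlace_algebraMap] at h
  have h1 : infinityValuation W u < WithZero.exp ((1 : ℕ) : ℤ) :=
    h.trans_lt (by rw [WithZero.exp_lt_exp]; simp)
  obtain ⟨p, q, rfl⟩ := exists_smul_basis_eq u
  rw [infinityValuation_lt_exp_iff] at h1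
  have hp : p = C (p.coeff 0) := by
    ext i
    rcases i with _ | i
    · simp
    · rw [h1.1 (i + 1) (by omega), coeff_C_succ]
  have hq : q = 0 := by
    ext i
    exact h1.2 i (by omega)
  refine ⟨p.coeff 0, ?_⟩
  rw [hp, hq, zero_smul, add_zero, coeff_C_zero, ← Algebra.algebraMap_eq_smul_one,
    IsScalarTower.algebraMap_apply k W.CoordinateRing W.FunctionField,
    IsScalarTower.algebraMap_apply k k[X] W.CoordinateRing]
  rfl

lemma finite_H0_zero [W.IsElliptic] : Module.Finite k (H0 (0 : Div k W.FunctionField)) := by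
  have h : H0 (0 : Div k W.FunctionField) ≤ k ∙ (1 : W.FunctionField) := fun f hf => by
    obtain ⟨c, rfl⟩ := exists_algebraMap_eq_of_mem_H0_zero hf
    exact Submodule.mem_span_singleton.mpr ⟨c, (Algebra.algebraMap_eq_smul_one c).symm⟩
  exact Submodule.finiteDimensional_of_le h

lemma finite_H0 [W.IsElliptic] (D : Div k W.FunctionField) : Module.Finite k (H0 D) :=
  finite_H0_of_finite_H0_zero deg_pos finite_H0_zero D

/-- The monomials `Xⁱ` with `2i ≤ n` and `XⁱY` with `2i + 3 ≤ n` are independent sections; there are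
`n / 2 + 1` and `(n - 1) / 2` of them, together `n`. -/
lemma le_finrank_H0_single_infinityPlace [W.IsElliptic] {n : ℕ} (hn : 0 < n) :
    n ≤ Module.finrank k (H0 (Finsupp.single (infinityPlace W) (n : ℤ))) := by
  have hmem : ∀ x : degreeLT k (n / 2 + 1) × degreeLT k ((n - 1) / 2),
      algebraMap W.CoordinateRing W.FunctionField
        ((x.1 : k[X]) • 1 + (x.2 : k[X]) • mk W Y) ∈
          H0 (Finsupp.single (infinityPlace W) (n : ℤ)) := by
    rintro ⟨⟨p, hp⟩, ⟨q, hq⟩⟩ P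
    by_cases hP : P = infinityPlace W
    · subst hP
      rw [Finsupp.single_eq_same, infinityPlace_algebraMap]
      have : infinityValuation W (p • 1 + q • mk W Y) < WithZero.exp ((n + 1 : ℕ) : ℤ) := by
        rw [mem_degreeLT, degree_lt_iff_coeff_zero] at hp hq
        rw [infinityValuation_lt_exp_iff]
        exact ⟨fun i hi => hp i (by omega), fun i hi => hq i (by omega)⟩
      rcases eq_or_ne (p • (1 : W.CoordinateRing) + q • mk W Y) 0 with h0 | h0
      · simp only [h0, map_zero]
        exact zero_le
      · rw [infinityValuation_of_ne_zero W h0, WithZero.exp_lt_exp] at this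
        rw [infinityValuation_of_ne_zero W h0, WithZero.exp_le_exp]
        push_cast at this
        omega
    · rw [Finsupp.single_eq_of_ne hP, WithZero.exp_zero]
      exact valuation_coordinateRing_le_one hP _
  let Φ : degreeLT k (n / 2 + 1) × degreeLT k ((n - 1) / 2) →ₗ[k]
      H0 (Finsupp.single (infinityPlace W) (n : ℤ)) :=
    { toFun := fun x => ⟨_, hmem x⟩
      map_add' := fun x y => Subtype.ext (by
        simp only [Prod.fst_add, Prod.snd_add, Submodule.coe_add, add_smul, map_add]
        abel)
      map_smul' := fun c x => Subtype.ext (by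
        simp only [Prod.smul_fst, Prod.smul_snd, Submodule.coe_smul, smul_assoc, ← smul_add,
          RingHom.id_apply]
        exact map_smul (IsScalarTower.toAlgHom k W.CoordinateRing W.FunctionField) c _) }
  have hinj : Function.Injective Φ := by
    rw [← LinearMap.ker_eq_bot, LinearMap.ker_eq_bot']
    rintro ⟨⟨p, hp⟩, ⟨q, hq⟩⟩ h
    have h1 : algebraMap W.CoordinateRing W.FunctionField (p • 1 + q • mk W Y) = 0 :=
      congrArg Subtype.val h
    rw [FaithfulSMul.algebraMap_eq_zero_iff] at h1
    obtain ⟨rfl, rfl⟩ := smul_basis_eq_zero h1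
    rfl
  have hfin := finite_H0 (Finsupp.single (infinityPlace W) (n : ℤ))
  have h := LinearMap.finrank_le_finrank_of_injective hinj
  rw [Module.finrank_prod, (degreeLTEquiv k _).finrank_eq, (degreeLTEquiv k _).finrank_eq,
    Module.finrank_fin_fun, Module.finrank_fin_fun] at h
  omega

/-- An effective affine divisor on which `u` vanishes has degree at most the order of the pole
of `u` at infinity. -/
lemma sum_deg_le_natDegree_norm [W.IsElliptic] {E : Multiset (Place k W.FunctionField)}
    (hE : ∀ Q ∈ E, Q ≠ infinityPlace W) {u : W.CoordinateRing} (hu : u ≠ 0)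
    (huE : u ∈ vanishingIdeal E) :
    (E.map Place.deg).sum ≤ (Algebra.norm k[X] u).natDegree := by
  refine (sum_deg_le_finrank E hE).trans ?_
  rw [← finrank_quotient_span_eq_natDegree_norm (CoordinateRing.basis W) hu]
  have := finite_quotient_span (k := k) hu
  have hle := (Ideal.span_singleton_le_iff_mem _).mpr huE
  exact LinearMap.finrank_le_finrank_of_surjective
    (f := (Ideal.Quotient.factorₐ k hle).toLinearMap) (Ideal.Quotient.factor_surjective hle)

/-- More distinct zeros than the degree of the norm would form a reduced divisor violating
`sum_deg_le_natDegree_norm`. -/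
lemma finite_zeros [W.IsElliptic] {u : W.CoordinateRing} (hu : u ≠ 0) :
    {P : Place k W.FunctionField | P ≠ infinityPlace W ∧
      P.valuation (algebraMap _ _ u) < 1}.Finite := by
  classical
  by_contra hinf
  obtain ⟨s, hs, hcard⟩ := Set.Infinite.exists_subset_card_eq hinf
    ((Algebra.norm k[X] u).natDegree + 1)
  have h := sum_deg_le_natDegree_norm (E := s.val) (fun Q hQ => (hs hQ).1) hu (fun P hP => by
    by_cases hPs : P ∈ s
    · rw [Multiset.count_eq_one_of_mem s.nodup hPs]
      exact le_exp_neg_one_of_lt_one (hs hPs).2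
    · rw [Multiset.count_eq_zero_of_notMem hPs]
      simpa using valuation_coordinateRing_le_one hP u)
  have h2 : s.card ≤ (s.val.map Place.deg).sum := by
    change s.card ≤ ∑ P ∈ s, P.deg
    rw [Finset.card_eq_sum_ones]
    exact Finset.sum_le_sum fun P _ => deg_pos P
  omega

/-- The affine part of the divisor of a nonzero polynomial function. -/
lemma exists_zeroDivisor [W.IsElliptic] {u : W.CoordinateRing} (hu : u ≠ 0) :
    ∃ Z : Div k W.FunctionField, Z (infinityPlace W) = 0 ∧
      (∀ P, P ≠ infinityPlace W → P.valuation (algebraMap _ _ u) = WithZero.exp (-Z P)) ∧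
      Z.deg ≤ (Algebra.norm k[X] u).natDegree := by
  classical
  let Z : Div k W.FunctionField := Finsupp.ofSupportFinite
    (fun P => if P = infinityPlace W then 0 else P.ord (algebraMap _ _ u)) (by
      refine (finite_zeros (k := k) hu).subset fun P hP => ?_
      rw [Function.mem_support] at hP
      have h : P ≠ infinityPlace W := fun h => hP (if_pos h)
      rw [if_neg h] at hP
      refine ⟨h, lt_of_le_of_ne (valuation_coordinateRing_le_one h u) fun h1 => hP ?_⟩
      rw [Place.ord, h1]
      simp)
  have hZ : ∀ P, P ≠ infinityPlace W →
      P.valuation (algebraMap _ _ u) = WithZero.exp (-Z P) := fun P hP => by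
    have : Z P = P.ord (algebraMap _ _ u) := if_neg hP
    rw [this, Place.ord, neg_neg, WithZero.exp_log]
    rw [Valuation.ne_zero_iff, Ne, FaithfulSMul.algebraMap_eq_zero_iff]
    exact hu
  have hZ0 : Z (infinityPlace W) = 0 := if_pos rfl
  refine ⟨Z, hZ0, hZ, ?_⟩
  obtain ⟨E, hE⟩ := exists_multisetDiv_eq (D := Z) (fun P => by
    by_cases hP : P = infinityPlace W
    · rw [hP, hZ0]; rfl
    · have := valuation_coordinateRing_le_one hP u
      rw [hZ P hP, ← WithZero.exp_zero, WithZero.exp_le_exp] at this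
      exact neg_nonpos.mp this)
  have hcount : ∀ P, Z P = E.count P := fun P => by rw [← hE, multisetDiv_apply]
  rw [← hE, deg_multisetDiv, Nat.cast_le]
  refine sum_deg_le_natDegree_norm (fun Q hQ h => ?_) hu fun P hP => ?_
  · have := Multiset.count_pos.mpr hQ
    have h2 := hcount Q
    rw [h, hZ0] at h2
    rw [h] at this
    omega
  · rw [hZ P hP, hcount]

/-- Riemann's inequality on an elliptic curve. -/
lemma deg_le_finrank_H0 [W.IsElliptic] (D : Div k W.FunctionField) :
    D.deg ≤ Module.finrank k (H0 D) := by
  classical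
  -- `E` is the affine part of the positive part of `D`; a function `u` vanishing on it has a zero
  -- divisor `Z` that bounds `D` away from infinity.
  obtain ⟨E, hE⟩ := exists_multisetDiv_eq (D := (D ⊔ 0).erase (infinityPlace W)) (fun P => by
    rw [Finsupp.erase_apply]
    split_ifs
    · rfl
    · exact le_sup_right)
  have hcount : ∀ P, ((D ⊔ 0).erase (infinityPlace W)) P = E.count P := fun P => by
    rw [← hE, multisetDiv_apply]
  obtain ⟨u, huE, hu⟩ := exists_ne_zero_mem_vanishingIdeal (k := k) E fun Q hQ h => by
    have h1 := Multiset.count_pos.mpr hQ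
    have h2 := hcount Q
    rw [h, Finsupp.erase_same] at h2
    rw [h] at h1
    omega
  obtain ⟨Z, hZ0, hZ, hZdeg⟩ := exists_zeroDivisor (k := k) hu
  set N := (Algebra.norm k[X] u).natDegree with hN
  -- The extra `1` ensures `N + n > 0`, as the lower bound for multiples of infinity requires.
  set n := (D (infinityPlace W)).toNat + 1 with hn
  have hle : D ≤ Z + Finsupp.single (infinityPlace W) (n : ℤ) := fun P => by
    by_cases hP : P = infinityPlace W
    · rw [hP, Finsupp.add_apply, hZ0, Finsupp.single_eq_same]
      omega
    · rw [Finsupp.add_apply, Finsupp.single_eq_of_ne hP, add_zero]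
      have h1 := huE P hP
      rw [hZ P hP, WithZero.exp_le_exp, ← hcount, Finsupp.erase_ne hP, neg_le_neg_iff] at h1
      exact le_sup_left.trans h1
  have h1 := finrank_H0_sub_deg_mono deg_pos finite_H0_zero hle
  have hu0 : algebraMap W.CoordinateRing W.FunctionField u ≠ 0 := by
    rwa [Ne, FaithfulSMul.algebraMap_eq_zero_iff]
  -- Division by `u` embeds `H⁰((N + n)∞)` into `H⁰(Z + n∞)`; thus `h⁰(Z + n∞) ≥ N + n ≥ deg (Z +
  -- n∞)`, and `h1` transfers this to `D`.
  have h2 := finrank_H0_le_of_mul_mem (D := Finsupp.single (infinityPlace W) ((N + n : ℕ) : ℤ))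
    (finite_H0 (Z + Finsupp.single (infinityPlace W) (n : ℤ))) (inv_ne_zero hu0) (fun g hg P => by
      by_cases hP : P = infinityPlace W
      · subst hP
        have h3 := hg (infinityPlace W)
        rw [Finsupp.single_eq_same] at h3
        rw [map_mul, map_inv₀, infinityPlace_algebraMap, infinityValuation_of_ne_zero W hu,
          Finsupp.add_apply, hZ0, Finsupp.single_eq_same, zero_add, ← WithZero.exp_neg]
        refine (mul_le_mul' le_rfl h3).trans ?_
        rw [← WithZero.exp_add, WithZero.exp_le_exp]
        push_cast
        omega
      · have h3 := hg P
        rw [Finsupp.single_eq_of_ne hP, WithZero.exp_zero] at h3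
        rw [map_mul, map_inv₀, hZ P hP, ← WithZero.exp_neg, neg_neg, Finsupp.add_apply,
          Finsupp.single_eq_of_ne hP, add_zero]
        exact mul_le_of_le_one_right' h3)
  have h3 := le_finrank_H0_single_infinityPlace (k := k) (W := W) (n := N + n) (by omega)
  rw [map_add, Div.deg_single, infinityPlace_deg] at h1
  push_cast at h1
  omega

lemma riemannInequality (W : WeierstrassCurve.Affine k) [W.IsElliptic] :
    RiemannInequality k W.FunctionField where
  deg_pos := deg_pos
  exists_algebraMap_eq _ := exists_algebraMap_eq_of_mem_H0_zero
  deg_le := deg_le_finrank_H0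

end CurveLB

/-! ### Line bundles on a curve satisfying the Riemann inequality of genus one. -/

namespace CurveLB

section Pic

variable {k : Type*} {K : Type*} [Field k] [Field K] [Algebra k K]

lemma Pic.mk_add (D D' : Div k K) : Pic.mk (D + D') = Pic.mk D + Pic.mk D' := rfl

lemma Pic.mk_sub (D D' : Div k K) : Pic.mk (D - D') = Pic.mk D - Pic.mk D' := rfl

lemma Pic.mk_eq_mk_iff {D D' : Div k K} :
    Pic.mk D = Pic.mk D' ↔ ∃ f : K, IsDivOf (D - D') f := by
  rw [eq_comm]
  refine QuotientAddGroup.eq.trans ?_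
  rw [neg_add_eq_sub]
  rfl

lemma Pic.mk_eq_zero_iff {D : Div k K} : Pic.mk D = 0 ↔ ∃ f : K, IsDivOf D f := by
  have h := Pic.mk_eq_mk_iff (D := D) (D' := 0)
  rwa [sub_zero] at h

/-- The line bundle of a point. -/
noncomputable abbrev pointDiv (P : Place k K) : Div k K := Finsupp.single P 1

lemma deg_pointDiv {P : Place k K} (hP : P.deg = 1) : Div.deg (pointDiv P) = 1 := by
  rw [Div.deg_single, hP]
  rfl

lemma pointDiv_nonneg (P : Place k K) : 0 ≤ pointDiv P := Finsupp.single_nonneg.mpr zero_le_one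

lemma one_mem_H0 {D : Div k K} (hD : 0 ≤ D) : (1 : K) ∈ H0 D := fun P => by
  rw [map_one, ← WithZero.exp_zero, WithZero.exp_le_exp]
  exact hD P

lemma H0_inf_sub_pointDiv (D : Div k K) {P Q : Place k K} (hPQ : P ≠ Q) :
    H0 (D - pointDiv P) ⊓ H0 (D - pointDiv Q) = H0 (D - pointDiv P - pointDiv Q) := by
  refine le_antisymm (fun f hf R => ?_) (le_inf (H0_mono (sub_single_le _ _)) ?_)
  · by_cases hR : R = P
    · have hRQ : R ≠ Q := hR ▸ hPQ
      refine (hf.1 R).trans ?_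
      simp [pointDiv, Finsupp.single_eq_of_ne hRQ]
    · refine (hf.2 R).trans ?_
      simp [pointDiv, Finsupp.single_eq_of_ne hR]
  · rw [sub_right_comm]
    exact H0_mono (sub_single_le _ _)

end Pic

namespace RiemannInequality

variable {k : Type*} {K : Type*} [Field k] [Field K] [Algebra k K]
  (h : RiemannInequality k K)

include h

lemma finite_H0 (D : Div k K) : Module.Finite k (H0 D) := by
  refine finite_H0_of_finite_H0_zero h.deg_pos ?_ D
  have hle : H0 (0 : Div k K) ≤ k ∙ (1 : K) := fun f hf => by
    obtain ⟨c, rfl⟩ := h.exists_algebraMap_eq f hf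
    exact Submodule.mem_span_singleton.mpr ⟨c, (Algebra.algebraMap_eq_smul_one c).symm⟩
  exact Submodule.finiteDimensional_of_le hle

/-- If `deg D < 0`, multiplication by `fⁿ` embeds `H⁰(-nD)`, of dimension at least `-n deg D`, into
the fixed finite-dimensional space `H⁰(𝒪)` for every `n`. Applied to `f` and `f⁻¹`, this gives
degree zero for principal divisors. -/
lemma deg_nonneg {D : Div k K} {f : K} (hf : f ≠ 0) (hfD : f ∈ H0 D) : 0 ≤ D.deg := by
  have key : ∀ n : ℕ, n * (-D.deg) ≤ Module.finrank k (H0 (0 : Div k K)) := fun n => by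
    have h1 := h.deg_le (-(n • D))
    have h2 := finrank_H0_le_of_mul_mem (h.finite_H0 (0 : Div k K)) (D := -(n • D))
      (pow_ne_zero n hf) (fun g hg => by
        have := mul_mem_H0 (pow_mem_H0 hfD n) hg
        rwa [add_neg_cancel] at this)
    rw [map_neg, map_nsmul, nsmul_eq_mul, ← mul_neg] at h1
    exact h1.trans (by exact_mod_cast h2)
  by_contra! hneg
  have := key (Module.finrank k (H0 (0 : Div k K)) + 1)
  push_cast at this
  nlinarith

lemma deg_eq_zero {D : Div k K} {f : K} (hf : IsDivOf D f) : D.deg = 0 := by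
  have h1 := h.deg_nonneg (D := -D) hf.1 fun P => (hf.valuation_eq P).le
  have h2 := h.deg_nonneg (D := D) (inv_ne_zero hf.1) fun P => by
    have := (hf.neg.valuation_eq P).le
    rwa [Finsupp.neg_apply, neg_neg] at this
  rw [map_neg] at h1
  omega

lemma deg_eq {D D' : Div k K} (hDD' : Pic.mk D = Pic.mk D') : D.deg = D'.deg := by
  obtain ⟨f, hf⟩ := Pic.mk_eq_mk_iff.mp hDD'
  have := h.deg_eq_zero hf
  rw [map_sub] at this
  omega

lemma hasDegree_iff {D : Div k K} {d : ℤ} : (Pic.mk D).HasDegree d ↔ D.deg = d :=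
  ⟨fun ⟨_, hD', hd⟩ => (h.deg_eq hD').symm.trans hd, fun hd => ⟨D, rfl, hd⟩⟩

lemma isPos_iff {D : Div k K} : (Pic.mk D).IsPos ↔ 0 < D.deg :=
  ⟨fun ⟨_, hd, hD⟩ => ((h.hasDegree_iff).mp hD).symm ▸ hd, fun hD => ⟨_, hD, D, rfl, rfl⟩⟩

/-- A zero of the section at `P` would make it a section of `𝒪(D - P)`, which has negative degree.
-/
lemma isDivOf_neg {D : Div k K} {f : K} (hf : f ≠ 0) (hfD : f ∈ H0 D) (hD : D.deg = 0) :
    IsDivOf (-D) f := by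
  refine isDivOf_of_valuation_eq hf fun P => ?_
  rw [Finsupp.neg_apply, neg_neg]
  refine le_antisymm (hfD P) ?_
  by_contra! hlt
  have h1 := h.deg_nonneg hf (mem_H0_sub_single hfD hlt)
  have h2 := h.deg_pos P
  rw [map_sub, hD, Div.deg_single] at h1
  omega

lemma H0_eq_bot {D : Div k K} (hD : D.deg = 0) (hD0 : Pic.mk D ≠ 0) : H0 D = ⊥ := by
  rw [Submodule.eq_bot_iff]
  intro f hf
  by_contra hf0
  refine hD0 (Pic.mk_eq_zero_iff.mpr ⟨f⁻¹, ?_⟩)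
  have := (h.isDivOf_neg hf0 hf hD).neg
  rwa [neg_neg] at this

/-- A line bundle of degree one is isomorphic to `𝒪(P)` for a rational point `P`. -/
lemma exists_pointDiv {D : Div k K} (hD : D.deg = 1) :
    ∃ P : Place k K, P.deg = 1 ∧ Pic.mk (pointDiv P) = Pic.mk D := by
  have hpos : 0 < Module.finrank k (H0 D) := by
    have := h.deg_le D
    omega
  have := h.finite_H0 D
  obtain ⟨⟨f, hf⟩, hf0⟩ := Module.finrank_pos_iff_exists_ne_zero.mp hpos
  have hf0' : f ≠ 0 := fun h0 => hf0 (Subtype.ext h0)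
  -- A section without zeros would trivialize a bundle of degree one. A zero at `P` leaves degree `1
  -- - deg P ≥ 0`, so `P` is rational and there are no further zeros.
  by_cases hP : ∃ P : Place k K, f ∈ H0 (D - pointDiv P)
  · obtain ⟨P, hP⟩ := hP
    have h1 := h.deg_nonneg hf0' hP
    have h2 := h.deg_pos P
    rw [map_sub, hD, Div.deg_single] at h1
    have hPdeg : P.deg = 1 := by omega
    refine ⟨P, hPdeg, Pic.mk_eq_mk_iff.mpr ⟨f, ?_⟩⟩
    have := h.isDivOf_neg hf0' hP (by rw [map_sub, hD, deg_pointDiv hPdeg, sub_self])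
    rwa [neg_sub] at this
  · exfalso
    push Not at hP
    have hdiv : IsDivOf (-D) f := isDivOf_of_valuation_eq hf0' fun P => by
      rw [Finsupp.neg_apply, neg_neg]
      refine le_antisymm (hf P) ?_
      by_contra! hlt
      exact hP P (mem_H0_sub_single hf hlt)
    have := h.deg_eq_zero hdiv
    rw [map_neg] at this
    omega

/-- The converse of Riemann's inequality, by removing rational points. Since `P` and `Q` are
inequivalent, removing one of them leaves a nontrivial bundle, so the induction ends at a nontrivial
bundle of degree zero, which has no sections. -/
lemma finrank_H0_le {P Q : Place k K} (hP : P.deg = 1) (hQ : Q.deg = 1)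
    (hPQ : Pic.mk (pointDiv P) ≠ Pic.mk (pointDiv Q)) (n : ℕ) :
    ∀ D : Div k K, D.deg = n → Pic.mk D ≠ 0 → Module.finrank k (H0 D) ≤ n := by
  induction n with
  | zero =>
    intro D hD hD0
    rw [h.H0_eq_bot hD hD0, finrank_bot]
  | succ n ih =>
    intro D hD hD0
    obtain ⟨R, hR, hDR⟩ : ∃ R : Place k K, R.deg = 1 ∧ Pic.mk (D - pointDiv R) ≠ 0 := by
      by_contra! hne
      have h1 := hne P hP
      have h2 := hne Q hQ
      rw [Pic.mk_sub, sub_eq_zero] at h1 h2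
      exact hPQ (h1.symm.trans h2)
    have h1 := finrank_H0_le_sub_single_add (h.deg_pos R) (h.finite_H0 D)
    have h2 := ih (D - pointDiv R) (by rw [map_sub, hD, deg_pointDiv hR]; push_cast; ring) hDR
    rw [hR] at h1
    exact h1.trans (Nat.succ_le_succ h2)

/-- A line bundle of degree at least two on an elliptic curve is generated by the sections vanishing
at one of two given points. -/
lemma H0_sup_eq {P Q : Place k K} (hP : P.deg = 1) (hQ : Q.deg = 1)
    (hPQ : Pic.mk (pointDiv P) ≠ Pic.mk (pointDiv Q)) {D : Div k K} (hD : 2 ≤ D.deg)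
    (hDPQ : Pic.mk D ≠ Pic.mk (pointDiv P) + Pic.mk (pointDiv Q)) :
    H0 (D - pointDiv P) ⊔ H0 (D - pointDiv Q) = H0 D := by
  have hdegP := deg_pointDiv hP
  have hdegQ := deg_pointDiv hQ
  have hfinP := h.finite_H0 (D - pointDiv P)
  have hfinQ := h.finite_H0 (D - pointDiv Q)
  have hfinD := h.finite_H0 D
  obtain ⟨m, hm⟩ : ∃ m : ℕ, D.deg = (m + 2 : ℕ) := ⟨(D.deg - 2).toNat, by omega⟩
  refine Submodule.eq_of_le_of_finrank_le
    (sup_le (H0_mono (sub_single_le _ _)) (H0_mono (sub_single_le _ _))) ?_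
  -- With `deg D = m + 2`, both subspaces have dimension at least `m + 1`, and their intersection
  -- `H⁰(D - P - Q)` has dimension at most `m`, the bundle being nontrivial. The sum reaches `m + 2
  -- ≥ h⁰(D)`.
  have h1 := Submodule.finrank_sup_add_finrank_inf_eq (H0 (D - pointDiv P)) (H0 (D - pointDiv Q))
  rw [H0_inf_sub_pointDiv D (fun e => hPQ (by rw [e]))] at h1
  have h2 := h.deg_le (D - pointDiv P)
  have h3 := h.deg_le (D - pointDiv Q)
  have h4 := h.finrank_H0_le hP hQ hPQ m (D - pointDiv P - pointDiv Q) (by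
    rw [map_sub, map_sub, hm, hdegP, hdegQ]; push_cast; ring) (by
    rw [Pic.mk_sub, Pic.mk_sub, sub_sub]
    exact sub_ne_zero.mpr hDPQ)
  have h5 := h.finrank_H0_le hP hQ hPQ (m + 2) D hm (fun h0 => by
    have := h.deg_eq (D := D) (D' := 0) h0
    rw [map_zero] at this
    omega)
  rw [map_sub, hm, hdegP] at h2
  rw [map_sub, hm, hdegQ] at h3
  push_cast at h2 h3
  omega

end RiemannInequality

end CurveLB

/-! ### Symbols: tensors for arbitrary divisors, independent of the chosen representatives. -/

namespace CurveLB

section Symbols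

variable {k : Type*} {K : Type*} [Field k] [Field K] [Algebra k K]

lemma RiemannInequality.exists_eq_algebraMap_mul (h : RiemannInequality k K) {D : Div k K} {f g : K}
    (hf : IsDivOf D f) (hg : IsDivOf D g) : ∃ c : k, c ≠ 0 ∧ f = algebraMap k K c * g := by
  obtain ⟨c, hc⟩ := h.exists_algebraMap_eq (f * g⁻¹) fun P => by
    have := ((hf.add hg.neg).valuation_eq P).le
    simpa using this
  have hg0 : g ≠ 0 := hg.1
  refine ⟨c, ?_, by rw [hc, inv_mul_cancel_right₀ hg0]⟩
  rintro rfl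
  rw [map_zero] at hc
  exact mul_ne_zero hf.1 (inv_ne_zero hg0) hc.symm

/-- The factorization `𝒪(D) = 𝒪(D - D₂) ⊗ 𝒪(D₂)` occurs in the middle term of the complex. -/
structure Admissible (D : Div k K) (S : Set (Pic k K)) (D₂ : Div k K) : Prop where
  pos₁ : 0 < Div.deg (D - D₂)
  pos₂ : 0 < Div.deg D₂
  mem : Pic.mk D₂ ∈ S

variable {D : Div k K} {S : Set (Pic k K)} (r : Representatives k K)

/-- The isomorphism class of an admissible factorization. -/
noncomputable def Admissible.index {D₂ : Div k K} (hA : Admissible D S D₂) : PairIndex D S where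
  c := Pic.mk D₂
  pos₁ := ⟨_, hA.pos₁, D - D₂, rfl, rfl⟩
  pos₂ := ⟨_, hA.pos₂, D₂, rfl, rfl⟩
  mem := hA.mem

lemma exists_isDivOf_sub_bundle (D₂ : Div k K) :
    ∃ f : K, IsDivOf (D₂ - r.bundle (Pic.mk D₂)) f :=
  Pic.mk_eq_mk_iff.mp (r.mk_bundle _).symm

lemma Admissible.exists_isDivOf {D₂ : Div k K} (hA : Admissible D S D₂) :
    ∃ f : K, IsDivOf (D₂ - r.bundle hA.index.c) f :=
  exists_isDivOf_sub_bundle r D₂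

lemma IsDivOf.inv_sub {D₂ M : Div k K} {f : K} (h : IsDivOf (D₂ - M) f) (D : Div k K) :
    IsDivOf ((D - D₂) - (D - M)) f⁻¹ := by
  have := h.neg
  rwa [show (D - D₂) - (D - M) = -(D₂ - M) by abel]

lemma transport_coe {D D' : Div k K} {f : K} (h : IsDivOf (D - D') f) (s : H0 D) :
    (transport h s : K) = f * s := rfl

lemma mulSections_tmul_coe {D₁ D₂ D₃ : Div k K} (h : D₁ + D₂ = D₃) (s : H0 D₁) (t : H0 D₂) :
    (mulSections h (s ⊗ₜ t) : K) = s * t := rfl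

open Classical in
/-- The map from `H⁰(D - D₂) ⊗ H⁰(D₂)` to the middle term of the complex, defined by
an isomorphism of `𝒪(D₂)` with the chosen representative. -/
noncomputable def symbol {D₂ : Div k K} (hA : Admissible D S D₂) :
    H0 (D - D₂) ⊗[k] H0 D₂ →ₗ[k] ⨁ p : PairIndex D S, PairSpace r p :=
  DirectSum.lof k (PairIndex D S) (PairSpace r) hA.index ∘ₗ
    TensorProduct.map (transport ((hA.exists_isDivOf r).choose_spec.inv_sub D))
      (transport (hA.exists_isDivOf r).choose_spec)

open Classical in
/-- The symbol does not depend on the isomorphism with the chosen representative. -/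
lemma lof_eq_symbol (h : RiemannInequality k K) {D₂ : Div k K} (hA : Admissible D S D₂)
    {p : PairIndex D S} (hp : p.c = Pic.mk D₂) {w : K} (hw : IsDivOf (D₂ - r.bundle p.c) w)
    (f : H0 (D - D₂)) (g : H0 D₂) (f' : H0 (D - r.bundle p.c)) (g' : H0 (r.bundle p.c))
    (hf' : (f' : K) = w⁻¹ * f) (hg' : (g' : K) = w * g) :
    DirectSum.lof k (PairIndex D S) (PairSpace r) p (f' ⊗ₜ g') = symbol r hA (f ⊗ₜ g) := by
  obtain rfl : p = hA.index := by
    cases p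
    cases hp
    rfl
  obtain ⟨c, hc, hcw⟩ := h.exists_eq_algebraMap_mul hw (hA.exists_isDivOf r).choose_spec
  rw [symbol, LinearMap.comp_apply, TensorProduct.map_tmul]
  congr 1
  -- Two isomorphisms differ by a constant `c`, which acts by `c⁻¹` on the first factor and `c` on
  -- the second and so cancels in the tensor product.
  have h1 : f' = c⁻¹ • transport ((hA.exists_isDivOf r).choose_spec.inv_sub D) f := by
    refine Subtype.ext ?_
    rw [Submodule.coe_smul, transport_coe, hf', hcw, Algebra.smul_def, map_inv₀, mul_inv, mul_assoc]
  have h2 : g' = c • transport (hA.exists_isDivOf r).choose_spec g := by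
    refine Subtype.ext ?_
    rw [Submodule.coe_smul, transport_coe, hg', hcw, Algebra.smul_def, mul_assoc]
  rw [h1, h2, TensorProduct.smul_tmul, smul_smul, inv_mul_cancel₀ hc, one_smul]

open Classical in
lemma beta_symbol {D₂ : Div k K} (hA : Admissible D S D₂) (f : H0 (D - D₂)) (g : H0 D₂) :
    (beta r D S (symbol r hA (f ⊗ₜ g)) : K) = f * g := by
  rw [symbol, LinearMap.comp_apply, TensorProduct.map_tmul, beta, DirectSum.toModule_lof]
  rw [mulSections_tmul_coe, transport_coe, transport_coe]
  have := (hA.exists_isDivOf r).choose_spec.1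
  field_simp

open Classical in
lemma alpha_lof (t : TripleIndex D S) (x : TripleSpace r t) :
    alpha r D S (DirectSum.lof k (TripleIndex D S) (TripleSpace r) t x) =
      DirectSum.lof k (PairIndex D S) (PairSpace r) t.left (mulLeft r t x) -
      DirectSum.lof k (PairIndex D S) (PairSpace r) t.right (mulRight r t x) := by
  rw [alpha, DirectSum.toModule_lof]
  rfl

lemma mulLeft_tmul (t : TripleIndex D S) (x : H0 (D - r.bundle t.a - r.bundle t.c))
    (y : H0 (r.bundle t.a)) (z : H0 (r.bundle t.c)) :
    mulLeft r t (x ⊗ₜ (y ⊗ₜ z)) = mulSections (by abel) (x ⊗ₜ[k] y) ⊗ₜ z := rfl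

lemma mulRight_tmul (t : TripleIndex D S) (x : H0 (D - r.bundle t.a - r.bundle t.c))
    (y : H0 (r.bundle t.a)) (z : H0 (r.bundle t.c)) :
    mulRight r t (x ⊗ₜ (y ⊗ₜ z)) = transport (r.isDivOf_iso_inv D t.a t.c) x ⊗ₜ
      transport (r.isDivOf_iso t.a t.c) (mulSections rfl (y ⊗ₜ[k] z)) := rfl

/-- The relation `s₁s₂ ⊗ s₃ = s₁ ⊗ s₂s₃`. -/
lemma symbol_sub_symbol_mem (h : RiemannInequality k K) {D₂ D₃ D₂₃ : Div k K}
    (hD : D₂₃ = D₂ + D₃) (h₃ : Admissible D S D₃) (h₂₃ : Admissible D S D₂₃)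
    (h₂ : 0 < Div.deg D₂) (f : H0 (D - D₂₃)) (g : H0 D₂) (w : H0 D₃) (x : H0 (D - D₃))
    (y : H0 D₂₃) (hx : (x : K) = f * g) (hy : (y : K) = g * w) :
    symbol r h₃ (x ⊗ₜ w) - symbol r h₂₃ (f ⊗ₜ y) ∈ LinearMap.range (alpha r D S) := by
  classical
  subst hD
  let t : TripleIndex D S :=
    { a := Pic.mk D₂
      c := Pic.mk D₃
      pos₁ := ⟨_, h₂₃.pos₁, D - (D₂ + D₃), by rw [Pic.mk_sub, Pic.mk_add, sub_sub], rfl⟩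
      pos₂ := ⟨_, h₂, D₂, rfl, rfl⟩
      pos₃ := ⟨_, h₃.pos₂, D₃, rfl, rfl⟩
      mem := h₃.mem
      mem_add := h₂₃.mem }
  obtain ⟨u₂, hu₂⟩ := exists_isDivOf_sub_bundle r D₂
  obtain ⟨u₃, hu₃⟩ := exists_isDivOf_sub_bundle r D₃
  have hu : IsDivOf ((D - (D₂ + D₃)) - (D - r.bundle t.a - r.bundle t.c)) (u₂⁻¹ * u₃⁻¹) := by
    have := hu₂.neg.add hu₃.neg
    rwa [show (D - (D₂ + D₃)) - (D - r.bundle t.a - r.bundle t.c) =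
      -(D₂ - r.bundle t.a) + -(D₃ - r.bundle t.c) by abel]
  -- The identification of `D₂ + D₃` with its representative produced by `mulRight`; `lof_eq_symbol`
  -- permits it in place of the one chosen in `symbol`.
  have hu₂₃ : IsDivOf (D₂ + D₃ - r.bundle t.right.c) (u₂ * u₃ * r.iso t.a t.c) := by
    have := (hu₂.add hu₃).add (r.isDivOf_iso t.a t.c)
    rwa [show D₂ + D₃ - r.bundle t.right.c = D₂ - r.bundle t.a + (D₃ - r.bundle t.c) +
      (r.bundle t.a + r.bundle t.c - r.bundle (t.a + t.c)) by abel]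
  have h2 := hu₂.1
  have h3 := hu₃.1
  refine ⟨DirectSum.lof k (TripleIndex D S) (TripleSpace r) t
    (transport hu f ⊗ₜ (transport hu₂ g ⊗ₜ transport hu₃ w)), ?_⟩
  rw [alpha_lof, mulLeft_tmul, mulRight_tmul]
  congr 1
  · refine lof_eq_symbol r h h₃ (p := t.left) rfl hu₃ x w _ _ ?_ (transport_coe _ _)
    rw [mulSections_tmul_coe, transport_coe, transport_coe, hx]
    field_simp
  · refine lof_eq_symbol r h h₂₃ (p := t.right) rfl hu₂₃ f y _ _ ?_ ?_
    · rw [transport_coe, transport_coe, mul_inv, mul_inv]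
      ring
    · rw [transport_coe, mulSections_tmul_coe, transport_coe, transport_coe, hy]
      ring

lemma beta_alpha (x : ⨁ t : TripleIndex D S, TripleSpace r t) :
    beta r D S (alpha r D S x) = 0 := by
  classical
  suffices h : beta r D S ∘ₗ alpha r D S = 0 from LinearMap.congr_fun h x
  refine DirectSum.linearMap_ext k fun t => ?_
  refine TensorProduct.ext' fun x yz => ?_
  induction yz using TensorProduct.induction_on with
  | zero => simp
  | add a b ha hb => rw [TensorProduct.tmul_add, map_add, map_add, ha, hb]
  | tmul y z =>
    rw [LinearMap.comp_apply, LinearMap.comp_apply, alpha_lof, mulLeft_tmul, mulRight_tmul,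
      map_sub, beta, DirectSum.toModule_lof, DirectSum.toModule_lof]
    refine Subtype.ext ?_
    have := (r.isDivOf_iso t.a t.c).1
    rw [Submodule.coe_sub]
    simp only [mulSections_tmul_coe, transport_coe]
    simp
    field_simp
    ring

end Symbols

end CurveLB

/-! ### Generators of the cokernel of `α`, and exactness. -/

namespace CurveLB

section Exactness

variable {k : Type*} {K : Type*} [Field k] [Field K] [Algebra k K]

/-- The constant section `1` of `𝒪(P)`. -/
def oneSection (P : Place k K) : H0 (pointDiv P) := ⟨1, one_mem_H0 (pointDiv_nonneg P)⟩

variable {L : Div k K} {S : Set (Pic k K)} (r : Representatives k K)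

/-- The classes in the cokernel of `α` of the sections of `L` vanishing at `P`. -/
noncomputable def pointSymbol {P : Place k K} (hP : Admissible L S (pointDiv P)) :
    H0 (L - pointDiv P) →ₗ[k] (⨁ p : PairIndex L S, PairSpace r p) ⧸
      LinearMap.range (alpha r L S) :=
  (LinearMap.range (alpha r L S)).mkQ ∘ₗ symbol r hP ∘ₗ
    (TensorProduct.mk k _ _).flip (oneSection P)

lemma pointSymbol_apply {P : Place k K} (hP : Admissible L S (pointDiv P))
    (f : H0 (L - pointDiv P)) : pointSymbol r hP f =
      (LinearMap.range (alpha r L S)).mkQ (symbol r hP (f ⊗ₜ oneSection P)) := rfl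

variable (h : RiemannInequality k K)

include h

lemma mkQ_symbol_eq {D₂ D₃ D₂₃ : Div k K}
    (hD : D₂₃ = D₂ + D₃) (h₃ : Admissible L S D₃) (h₂₃ : Admissible L S D₂₃)
    (h₂ : 0 < Div.deg D₂) (f : H0 (L - D₂₃)) (g : H0 D₂) (w : H0 D₃) (x : H0 (L - D₃))
    (y : H0 D₂₃) (hx : (x : K) = f * g) (hy : (y : K) = g * w) :
    (LinearMap.range (alpha r L S)).mkQ (symbol r h₃ (x ⊗ₜ w)) =
      (LinearMap.range (alpha r L S)).mkQ (symbol r h₂₃ (f ⊗ₜ y)) := by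
  rw [← sub_eq_zero, ← map_sub, Submodule.mkQ_apply, Submodule.Quotient.mk_eq_zero]
  exact symbol_sub_symbol_mem r h hD h₃ h₂₃ h₂ f g w x y hx hy

variable {B : Submodule k ((⨁ p : PairIndex L S, PairSpace r p) ⧸ LinearMap.range (alpha r L S))}

/-- The second factor can be moved to the first one, up to sections of line bundles of
degree one. -/
lemma mkQ_symbol_mem_of_two_le {D₂ : Div k K} (hA : Admissible L S D₂) (h2 : 2 ≤ D₂.deg)
    {P Q : Place k K} (hP : P.deg = 1) (hQ : Q.deg = 1)
    (hPQ : Pic.mk (pointDiv P) ≠ Pic.mk (pointDiv Q))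
    (hne : Pic.mk D₂ ≠ Pic.mk (pointDiv P) + Pic.mk (pointDiv Q))
    (hAP : Admissible L S (pointDiv P)) (hAQ : Admissible L S (pointDiv Q))
    (hBP : LinearMap.range (pointSymbol r hAP) ≤ B)
    (hBQ : LinearMap.range (pointSymbol r hAQ) ≤ B) (s : H0 (L - D₂)) (t : H0 D₂) :
    (LinearMap.range (alpha r L S)).mkQ (symbol r hA (s ⊗ₜ t)) ∈ B := by
  have key : ∀ {R : Place k K}, R.deg = 1 → ∀ hAR : Admissible L S (pointDiv R),
      LinearMap.range (pointSymbol r hAR) ≤ B → ∀ y (hy : y ∈ H0 (D₂ - pointDiv R)) (hy' : y ∈ H0 D₂),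
      (LinearMap.range (alpha r L S)).mkQ (symbol r hA (s ⊗ₜ ⟨y, hy'⟩)) ∈ B := by
    intro R hR hAR hB y hy hy'
    have hmem : (s : K) * y ∈ H0 (L - pointDiv R) := by
      have := mul_mem_H0 s.2 hy
      rwa [show L - D₂ + (D₂ - pointDiv R) = L - pointDiv R by abel] at this
    -- Writing `y = y · 1_R` with `y` a section of `D₂ - R`, of positive degree, gives `s ⊗ y ≡ sy ⊗
    -- 1_R`.
    rw [← mkQ_symbol_eq r h (sub_add_cancel D₂ (pointDiv R)).symm hAR hA
      (by rw [map_sub, deg_pointDiv hR]; omega) s ⟨y, hy⟩ (oneSection R) ⟨_, hmem⟩ _ rfl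
      (mul_one y).symm, ← pointSymbol_apply]
    exact hB ⟨_, rfl⟩
  obtain ⟨y, hy, z, hz, hyz⟩ := Submodule.mem_sup.mp ((h.H0_sup_eq hP hQ hPQ h2 hne).ge t.2)
  have hy' : y ∈ H0 D₂ := H0_mono (sub_single_le _ _) hy
  have hz' : z ∈ H0 D₂ := H0_mono (sub_single_le _ _) hz
  have : t = ⟨y, hy'⟩ + ⟨z, hz'⟩ := Subtype.ext hyz.symm
  rw [this, TensorProduct.tmul_add, map_add, map_add]
  exact B.add_mem (key hP hAP hBP y hy hy') (key hQ hAQ hBQ z hz hz')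

/-- The first factor can be moved to the second one, up to sections of line bundles of
degree one. -/
lemma mkQ_symbol_mem_of_two_le_sub {D₂ : Div k K} (hA : Admissible L S D₂)
    (h2 : 2 ≤ (L - D₂).deg) {P Q : Place k K} (hP : P.deg = 1) (hQ : Q.deg = 1)
    (hPQ : Pic.mk (pointDiv P) ≠ Pic.mk (pointDiv Q))
    (hne : Pic.mk (L - D₂) ≠ Pic.mk (pointDiv P) + Pic.mk (pointDiv Q))
    (hAP : Admissible L S (L - pointDiv P)) (hAQ : Admissible L S (L - pointDiv Q))
    (hBP : ∀ s t, (LinearMap.range (alpha r L S)).mkQ (symbol r hAP (s ⊗ₜ t)) ∈ B)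
    (hBQ : ∀ s t, (LinearMap.range (alpha r L S)).mkQ (symbol r hAQ (s ⊗ₜ t)) ∈ B)
    (s : H0 (L - D₂)) (t : H0 D₂) :
    (LinearMap.range (alpha r L S)).mkQ (symbol r hA (s ⊗ₜ t)) ∈ B := by
  have key : ∀ {R : Place k K}, R.deg = 1 → ∀ hAR : Admissible L S (L - pointDiv R),
      (∀ s t, (LinearMap.range (alpha r L S)).mkQ (symbol r hAR (s ⊗ₜ t)) ∈ B) →
      ∀ y (hy : y ∈ H0 (L - D₂ - pointDiv R)) (hy' : y ∈ H0 (L - D₂)),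
      (LinearMap.range (alpha r L S)).mkQ (symbol r hA (⟨y, hy'⟩ ⊗ₜ t)) ∈ B := by
    intro R hR hAR hB y hy hy'
    have hmem : y * (t : K) ∈ H0 (L - pointDiv R) := by
      have := mul_mem_H0 hy t.2
      rwa [show L - D₂ - pointDiv R + D₂ = L - pointDiv R by abel] at this
    have hone : (1 : K) ∈ H0 (L - (L - pointDiv R)) := by
      rw [sub_sub_cancel]
      exact one_mem_H0 (pointDiv_nonneg R)
    -- Here `1_R` is a section of `L - (L - R)`, and `(1_R · y) ⊗ t ≡ 1_R ⊗ yt`.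
    rw [mkQ_symbol_eq r h (D₂ := L - D₂ - pointDiv R) (by abel) hA hAR
      (by rw [map_sub, deg_pointDiv hR]; omega) ⟨1, hone⟩ ⟨y, hy⟩ t _ ⟨_, hmem⟩ (one_mul y).symm
      rfl]
    exact hB _ _
  obtain ⟨y, hy, z, hz, hyz⟩ := Submodule.mem_sup.mp ((h.H0_sup_eq hP hQ hPQ h2 hne).ge s.2)
  have hy' : y ∈ H0 (L - D₂) := H0_mono (sub_single_le _ _) hy
  have hz' : z ∈ H0 (L - D₂) := H0_mono (sub_single_le _ _) hz
  have : s = ⟨y, hy'⟩ + ⟨z, hz'⟩ := Subtype.ext hyz.symm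
  rw [this, TensorProduct.add_tmul, map_add, map_add]
  exact B.add_mem (key hP hAP hBP y hy hy') (key hQ hAQ hBQ z hz hz')

lemma mkQ_mem_of_mkQ_symbol_mem
    (hB : ∀ (D₂ : Div k K) (hA : Admissible L S D₂) (s : H0 (L - D₂)) (t : H0 D₂),
      (LinearMap.range (alpha r L S)).mkQ (symbol r hA (s ⊗ₜ t)) ∈ B)
    (z : ⨁ p : PairIndex L S, PairSpace r p) : (LinearMap.range (alpha r L S)).mkQ z ∈ B := by
  classical
  rw [← Submodule.Quotient.mk_eq_zero, ← Submodule.mkQ_apply, ← LinearMap.comp_apply]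
  suffices hle : B.mkQ ∘ₗ (LinearMap.range (alpha r L S)).mkQ = 0 by rw [hle, LinearMap.zero_apply]
  refine DirectSum.linearMap_ext k fun p => TensorProduct.ext' fun f g => ?_
  have hA : Admissible L S (r.bundle p.c) :=
    ⟨(h.isPos_iff).mp (by rw [Pic.mk_sub, r.mk_bundle]; exact p.pos₁),
      (h.isPos_iff).mp (by rw [r.mk_bundle]; exact p.pos₂), by rw [r.mk_bundle]; exact p.mem⟩
  have := lof_eq_symbol r h hA (r.mk_bundle p.c).symm (w := 1)
    (by rw [sub_self]; exact IsDivOf.zero) f g f g (by rw [inv_one, one_mul])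
    (by rw [one_mul])
  rw [LinearMap.comp_apply, this, LinearMap.comp_apply, Submodule.mkQ_apply,
    (Submodule.Quotient.mk_eq_zero _).mpr (hB _ hA f g)]
  rfl

/-- `T` collects the finitely many classes that the chosen point has to avoid. -/
lemma exists_pointDiv_mem
    (hS : ∀ d : ℤ, ∀ c₁ : Pic k K, {c | c ∈ S ∧ c.HasDegree d ∧ c₁ + c ∈ S}.Infinite)
    (c₁ : Pic k K) (T : Finset (Pic k K)) : ∃ P : Place k K, P.deg = 1 ∧
      Pic.mk (pointDiv P) ∈ S ∧ c₁ + Pic.mk (pointDiv P) ∈ S ∧ Pic.mk (pointDiv P) ∉ T := by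
  obtain ⟨c, ⟨hcS, ⟨D, rfl, hD⟩, hc₁⟩, hcT⟩ := ((hS 1 c₁).sdiff T.finite_toSet).nonempty
  obtain ⟨P, hP, hPD⟩ := h.exists_pointDiv hD
  exact ⟨P, hP, hPD ▸ hcS, hPD ▸ hc₁, hPD ▸ hcT⟩

lemma exists_sub_pointDiv_mem
    (hS : ∀ d : ℤ, ∀ c₁ : Pic k K, {c | c ∈ S ∧ c.HasDegree d ∧ c₁ + c ∈ S}.Infinite)
    (L : Div k K) (T : Finset (Pic k K)) : ∃ P : Place k K, P.deg = 1 ∧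
      Pic.mk (L - pointDiv P) ∈ S ∧ Pic.mk (L - pointDiv P) ∉ T := by
  obtain ⟨c, ⟨hcS, ⟨D, rfl, hD⟩, -⟩, hcT⟩ := ((hS (L.deg - 1) 0).sdiff T.finite_toSet).nonempty
  obtain ⟨P, hP, hPD⟩ := h.exists_pointDiv (D := L - D) (by rw [map_sub, hD]; ring)
  have : Pic.mk (L - pointDiv P) = Pic.mk D := by
    rw [Pic.mk_sub, hPD, Pic.mk_sub, sub_sub_cancel]
  exact ⟨P, hP, this ▸ hcS, this ▸ hcT⟩

omit h in
lemma admissible_pointDiv (hL : 3 ≤ L.deg) {R : Place k K} (hR : R.deg = 1)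
    (hRS : Pic.mk (pointDiv R) ∈ S) : Admissible L S (pointDiv R) :=
  ⟨by rw [map_sub, deg_pointDiv hR]; omega, by rw [deg_pointDiv hR]; omega, hRS⟩

omit h in
lemma admissible_sub_pointDiv (hL : 3 ≤ L.deg) {R : Place k K} (hR : R.deg = 1)
    (hRS : Pic.mk (L - pointDiv R) ∈ S) : Admissible L S (L - pointDiv R) :=
  ⟨by rw [sub_sub_cancel, deg_pointDiv hR]; omega, by rw [map_sub, deg_pointDiv hR]; omega, hRS⟩

section TwoPoints

variable {P Q : Place k K} (hP : P.deg = 1) (hQ : Q.deg = 1)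
  (hPQ : Pic.mk (pointDiv P) ≠ Pic.mk (pointDiv Q))
  (hAP : Admissible L S (pointDiv P)) (hAQ : Admissible L S (pointDiv Q))
  (hL : 3 ≤ L.deg)
  (hS : ∀ d : ℤ, ∀ c₁ : Pic k K, {c | c ∈ S ∧ c.HasDegree d ∧ c₁ + c ∈ S}.Infinite)

include hP hQ hPQ hL hS

/-- A second factor of degree one leaves no positive degree to split off. Instead the first factor,
of degree at least two, is moved across, giving second factors `L - R` and `L - R'`; these again
have degree at least two and can be split at `P` and `Q`. -/
lemma mkQ_symbol_mem_of_deg_eq_one {D₂ : Div k K} (hA : Admissible L S D₂) (h1 : D₂.deg = 1)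
    (s : H0 (L - D₂)) (t : H0 D₂) :
    (LinearMap.range (alpha r L S)).mkQ (symbol r hA (s ⊗ₜ t)) ∈
      LinearMap.range (pointSymbol r hAP) ⊔ LinearMap.range (pointSymbol r hAQ) := by
  classical
  obtain ⟨R, hR, hRS, hRT⟩ := exists_sub_pointDiv_mem h hS L
    {Pic.mk (pointDiv P) + Pic.mk (pointDiv Q)}
  -- The three excluded classes ensure, in order, `L - R' ≁ P + Q`, `R' ≁ R` and `L - D₂ ≁ R + R'`.
  obtain ⟨R', hR', hRS', hRT'⟩ := exists_sub_pointDiv_mem h hS L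
    {Pic.mk (pointDiv P) + Pic.mk (pointDiv Q), Pic.mk (L - pointDiv R),
      Pic.mk (D₂ + pointDiv R)}
  rw [Finset.mem_singleton] at hRT
  simp only [Finset.mem_insert, Finset.mem_singleton, not_or] at hRT'
  have hB₂ : ∀ {R : Place k K}, R.deg = 1 →
      Pic.mk (L - pointDiv R) ≠ Pic.mk (pointDiv P) + Pic.mk (pointDiv Q) →
      ∀ (hAR : Admissible L S (L - pointDiv R)) s t,
        (LinearMap.range (alpha r L S)).mkQ (symbol r hAR (s ⊗ₜ t)) ∈
          LinearMap.range (pointSymbol r hAP) ⊔ LinearMap.range (pointSymbol r hAQ) :=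
    fun hR hne hAR s t => mkQ_symbol_mem_of_two_le r h hAR
      (by rw [map_sub, deg_pointDiv hR]; omega) hP hQ hPQ hne hAP hAQ le_sup_left le_sup_right s t
  refine mkQ_symbol_mem_of_two_le_sub r h hA (by rw [map_sub]; omega) hR hR' ?_ ?_
    (admissible_sub_pointDiv hL hR hRS) (admissible_sub_pointDiv hL hR' hRS')
    (hB₂ hR hRT _) (hB₂ hR' hRT'.1 _) s t
  · intro e
    refine hRT'.2.1 ?_
    rw [Pic.mk_sub, Pic.mk_sub, e]
  · intro e
    refine hRT'.2.2 ?_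
    rw [Pic.mk_sub] at e
    rw [Pic.mk_sub, Pic.mk_add, sub_eq_iff_eq_add, add_assoc, ← e, add_sub_cancel]

lemma mkQ_symbol_mem {D₂ : Div k K} (hA : Admissible L S D₂) (s : H0 (L - D₂)) (t : H0 D₂) :
    (LinearMap.range (alpha r L S)).mkQ (symbol r hA (s ⊗ₜ t)) ∈
      LinearMap.range (pointSymbol r hAP) ⊔ LinearMap.range (pointSymbol r hAQ) := by
  classical
  have hpos := hA.pos₂
  rcases (show D₂.deg = 1 ∨ 2 ≤ D₂.deg by omega) with h1 | h2
  · exact mkQ_symbol_mem_of_deg_eq_one r h hP hQ hPQ hAP hAQ hL hS hA h1 s t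
  -- `D₂` may be equivalent to `P + Q`, so it is split at `P` and an auxiliary `R`; the symbols at
  -- `R` are covered by the case of degree one.
  obtain ⟨R, hR, hRS, -, hRT⟩ := exists_pointDiv_mem h hS 0
    {Pic.mk (pointDiv P), Pic.mk (D₂ - pointDiv P)}
  simp only [Finset.mem_insert, Finset.mem_singleton, not_or] at hRT
  have hne : Pic.mk D₂ ≠ Pic.mk (pointDiv P) + Pic.mk (pointDiv R) := fun e => by
    refine hRT.2 ?_
    rw [Pic.mk_sub, e, add_sub_cancel_left]
  have hAR := admissible_pointDiv hL hR hRS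
  have hBR : LinearMap.range (pointSymbol r hAR) ≤
      LinearMap.range (pointSymbol r hAP) ⊔ LinearMap.range (pointSymbol r hAQ) := by
    rintro _ ⟨f, rfl⟩
    rw [pointSymbol_apply]
    exact mkQ_symbol_mem_of_deg_eq_one r h hP hQ hPQ hAP hAQ hL hS hAR (deg_pointDiv hR) f _
  exact mkQ_symbol_mem_of_two_le r h hA h2 hP hR (Ne.symm hRT.1) hne hAP hAR le_sup_left hBR s t

lemma exists_sub_symbol_mem (z : ⨁ p : PairIndex L S, PairSpace r p) :
    ∃ (u : H0 (L - pointDiv P)) (v : H0 (L - pointDiv Q)),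
      z - (symbol r hAP (u ⊗ₜ oneSection P) + symbol r hAQ (v ⊗ₜ oneSection Q)) ∈
        LinearMap.range (alpha r L S) := by
  obtain ⟨_, ⟨u, rfl⟩, _, ⟨v, rfl⟩, huv⟩ := Submodule.mem_sup.mp
    (mkQ_mem_of_mkQ_symbol_mem r h
      (fun _ hA => mkQ_symbol_mem r h hP hQ hPQ hAP hAQ hL hS hA) z)
  refine ⟨u, v, ?_⟩
  rwa [pointSymbol_apply, pointSymbol_apply, ← map_add, eq_comm, ← sub_eq_zero, ← map_sub,
    Submodule.mkQ_apply, Submodule.Quotient.mk_eq_zero] at huv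

-- The relation between the two families of generators: `u` vanishes at both points, so it is a
-- section of `L - P - Q`, and both symbols equal `u ⊗ 1` for the second factor `P + Q`.
-- Admissibility of `P + Q` is essential here.
omit hL hS hP hQ in
lemma symbol_sub_symbol_oneSection_mem (hAPQ : Admissible L S (pointDiv P + pointDiv Q))
    (u : H0 (L - pointDiv P)) (v : H0 (L - pointDiv Q)) (huv : (u : K) = v) :
    symbol r hAP (u ⊗ₜ oneSection P) - symbol r hAQ (v ⊗ₜ oneSection Q) ∈
      LinearMap.range (alpha r L S) := by
  have hu : (u : K) ∈ H0 (L - (pointDiv P + pointDiv Q)) := by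
    rw [← sub_sub, ← H0_inf_sub_pointDiv L (fun e => hPQ (by rw [e]))]
    exact ⟨u.2, huv ▸ v.2⟩
  have hone : (1 : K) ∈ H0 (pointDiv P + pointDiv Q) :=
    one_mem_H0 (add_nonneg (pointDiv_nonneg P) (pointDiv_nonneg Q))
  have e1 := symbol_sub_symbol_mem r h (add_comm _ _) hAP hAPQ hAQ.pos₂
    ⟨u, hu⟩ (oneSection Q) (oneSection P) u ⟨1, hone⟩ (mul_one _).symm (mul_one _).symm
  have e2 := symbol_sub_symbol_mem r h rfl hAQ hAPQ hAP.pos₂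
    ⟨u, hu⟩ (oneSection P) (oneSection Q) v ⟨1, hone⟩ (huv.symm.trans (mul_one _).symm)
    (mul_one _).symm
  have e3 := Submodule.sub_mem _ e1 e2
  rwa [sub_sub_sub_cancel_right] at e3

lemma mem_range_alpha (hAPQ : Admissible L S (pointDiv P + pointDiv Q))
    (hAP : Admissible L S (pointDiv P)) (hAQ : Admissible L S (pointDiv Q))
    {z : ⨁ p : PairIndex L S, PairSpace r p} (hz : beta r L S z = 0) :
    z ∈ LinearMap.range (alpha r L S) := by
  obtain ⟨u, v, a, ha⟩ := exists_sub_symbol_mem r h hP hQ hPQ hAP hAQ hL hS z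
  have hβ := beta_alpha r a
  rw [ha, map_sub, hz, map_add, zero_sub, neg_eq_zero] at hβ
  have huv : (u : K) + v = 0 := by
    have := congrArg Subtype.val hβ
    rw [Submodule.coe_add, beta_symbol, beta_symbol] at this
    simpa [oneSection] using this
  have e := symbol_sub_symbol_oneSection_mem r h hPQ hAP hAQ hAPQ u (-v)
    (eq_neg_of_add_eq_zero_left huv)
  have hneg : symbol r hAQ ((-v) ⊗ₜ oneSection Q) = -symbol r hAQ (v ⊗ₜ oneSection Q) :=
    eq_neg_of_add_eq_zero_left (by
      rw [← map_add, ← TensorProduct.add_tmul, neg_add_cancel, TensorProduct.zero_tmul, map_zero])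
  rw [hneg, sub_neg_eq_add] at e
  rw [← sub_add_cancel z (symbol r hAP (u ⊗ₜ oneSection P) + symbol r hAQ (v ⊗ₜ oneSection Q))]
  exact Submodule.add_mem _ ⟨a, ha⟩ e

omit hS in
lemma beta_surjective (hAP : Admissible L S (pointDiv P)) (hAQ : Admissible L S (pointDiv Q)) :
    Function.Surjective (beta r L S) := by
  intro x
  obtain ⟨y, hy, z, hz, hyz⟩ := Submodule.mem_sup.mp
    -- Degree at least three excludes `L ∼ P + Q`.
    ((h.H0_sup_eq hP hQ hPQ (D := L) (by omega) (fun e => by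
      rw [← Pic.mk_add] at e
      have := h.deg_eq e
      rw [map_add, deg_pointDiv hP, deg_pointDiv hQ] at this
      omega)).ge x.2)
  refine ⟨symbol r hAP (⟨y, hy⟩ ⊗ₜ oneSection P) + symbol r hAQ (⟨z, hz⟩ ⊗ₜ oneSection Q), ?_⟩
  refine Subtype.ext ?_
  rw [map_add, Submodule.coe_add, beta_symbol, beta_symbol]
  simpa [oneSection] using hyz

end TwoPoints

theorem exact_alpha_beta (hL : 3 ≤ L.deg)
    (hS : ∀ d : ℤ, ∀ c₁ : Pic k K, {c | c ∈ S ∧ c.HasDegree d ∧ c₁ + c ∈ S}.Infinite) :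
    Function.Exact (alpha r L S) (beta r L S) ∧ Function.Surjective (beta r L S) := by
  classical
  obtain ⟨P, hP, hPS, -, -⟩ := exists_pointDiv_mem h hS 0 ∅
  -- The class of `P` serves as translate, so that `[P] + [Q] ∈ S` and `P + Q` is admissible.
  obtain ⟨Q, hQ, hQS, hPQS, hPQ⟩ := exists_pointDiv_mem h hS (Pic.mk (pointDiv P))
    {Pic.mk (pointDiv P)}
  replace hPQ : Pic.mk (pointDiv P) ≠ Pic.mk (pointDiv Q) := by
    rw [Finset.mem_singleton] at hPQ
    exact Ne.symm hPQ
  have hAP := admissible_pointDiv hL hP hPS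
  have hAQ := admissible_pointDiv hL hQ hQS
  have hAPQ : Admissible L S (pointDiv P + pointDiv Q) :=
    ⟨by rw [map_sub, map_add, deg_pointDiv hP, deg_pointDiv hQ]; omega,
      by rw [map_add, deg_pointDiv hP, deg_pointDiv hQ]; omega, hPQS⟩
  refine ⟨fun z => ⟨fun hz => mem_range_alpha r h hP hQ hPQ hL hS hAPQ hAP hAQ hz, ?_⟩,
    beta_surjective r h hP hQ hPQ hL hAP hAQ⟩
  rintro ⟨a, rfl⟩
  exact beta_alpha r a

end Exactness

end CurveLB

theorem mainTheorem4 {k : Type*} [Field k] (W : WeierstrassCurve k) [W.IsElliptic]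
    (L : CurveLB.Div k W.toAffine.FunctionField) (hL : 3 ≤ L.deg)
    (S : Set (CurveLB.Pic k W.toAffine.FunctionField))
    (hS : ∀ (d : ℤ) (c₁ c₂ : CurveLB.Pic k W.toAffine.FunctionField),
      {c | c ∈ S ∧ c.HasDegree d ∧ 2 • c ∈ S ∧ c₁ + c ∈ S ∧ c₂ - c ∈ S}.Infinite)
    (r : CurveLB.Representatives k W.toAffine.FunctionField) :
    Function.Exact (CurveLB.alpha r L S) (CurveLB.beta r L S) ∧
      Function.Surjective (CurveLB.beta r L S) :=
  CurveLB.exact_alpha_beta r (CurveLB.riemannInequality W) hL fun d c₁ =>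
    (hS d c₁ 0).mono fun _ hc => ⟨hc.1, hc.2.1, hc.2.2.2.1⟩
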